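/- **Setting.** Let $G$ be a second countable locally compact Hausdorff group with identity $e$, and let $X$ be a second countable topological space whose Borel structure is standard (for instance, a second countable locally compact Hausdorff space). A *partial action* $\alpha$ of $G$ on $X$ consists of open sets $X_t\subseteq X$ and homeomorphisms $\alpha_t:X_{t^{-1}}\to X_t$ $(t\in G)$ such that $\{(t,x): x\in X_{t^{-1}}\}$ is open in $G\times X$, $(t,x)\mapsto\alpha_t(x)$ is continuous on it, $X_e=X$, and $\alpha_{st}$ extends $\alpha_s\alpha_t$ for all $s,t\in G$. It is *partially transitive* if $X=\bigcup_{r\in G}X_{sr}\cap X_{tr}$ for all $s,t\in G$. The *enveloping space* $X^e$ is the topological quotient of $X\times G$ by $(x,r)\sim(y,s)\iff x\in X_{r^{-1}s},\ \alpha_{s^{-1}r}(x)=y$, with its Borel structure and the global action $\alpha^e_s([x,t])=[x,st]$; put $\iota:X\to X^e$, $\iota(x)=[x,e]$. On $X$ let $y\approx y'$ iff $[y,r]=[y',r']$ for some $r,r'\in G$. Let $Y=X/{\approx}$ with the quotient Borel structure, the quotient map $p:X\to Y$, the sets $Y_t=p(X_t)$ and the maps $\tilde\alpha_t([x])=[\alpha_t(x)]$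 for $x\in X_{t^{-1}}$. Let $\nu$ be a $\sigma$-finite quasi-invariant Borel measure on $X$ (that is, $\nu(B)=0$ implies $\nu(\alpha_s(B))=0$ for every $s\in G$ and every Borel set $B\subseteq X_{s^{-1}}$). The space $X^e$ carries a $\sigma$-finite quasi-invariant measure $\nu^e$ with $\nu^e(\iota(B))=0\iff\nu(B)=0$ for Borel $B\subseteq X$, and $Y$ carries $p_*\nu$. **Zimmer amenability.** Let $Z$ be one of $X$, $X^e$, $Y$, with its sets $Z_s$, maps $\beta_s:Z_{s^{-1}}\to Z_s$ and measure ($Z_s=X^e$ for all $s$ if $Z=X^e$). Scalars are real or complex, the same throughout. For a separable Banach space $E$, let $\mathrm{Iso}(E)$ be the group of surjective linear isometries of $E$ with the Borel structure of the strong operator topology, and $E^*_1$ the closed unit ball of $E^*$ with the weak* topology. A *partial 2-cocycle* is a Borel map $\sigma:\{(z,s)\in Z\times G: z\in Z_{s^{-1}}\}\to\mathrm{Iso}(E)$ with $\sigma(z,ts)=\sigma(z,s)\,\sigma(\beta_s(z),t)$ whenever the three terms are defined; put $\sigma^*(z,s)=(\sigma(z,s)^{-1})^*$. A *$\sigma$-invariant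 Borel field* is a family $(A_z)_{z\in Z}$ of non-empty compact convex subsets of $E^*_1$ such that $\{(z,\varphi):\varphi\in A_z\}$ is Borel in $Z\times E^*_1$ and, for every $s\in G$, $\sigma^*(z,s)A_{\beta_s(z)}=A_z$ for a.e. $z\in Z_{s^{-1}}$. Then $Z$ is *amenable in the sense of Zimmer* if for all $E$, $\sigma$, $(A_z)$ as above there is a Borel map $\eta:Z\to E^*_1$ with $\eta(z)\in A_z$ for a.e. $z\in Z$ and, for every $s\in G$, $\sigma^*(z,s)\eta(\beta_s(z))=\eta(z)$ for a.e. $z\in Z_{s^{-1}}$. **Theorem.** Let $\alpha$ be a partially transitive partial action of $G$ on $X$. For any such $\nu$ and $\nu^e$: 1. If $X^e$ is amenable in the sense of Zimmer, then so is $X$. 2. If $Y=X/{\approx}$ is amenable in the sense of Zimmer, then so is $X^e$. -/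

import Mathlib

open MeasureTheory Set

universe u

/-! ### Partial maps and partial actions -/

/-- A family of sets `X_t` (`dom t`) and of maps `α_t : X_{t⁻¹} → X_t` indexed by a group.
`act t` is a total function of which only the values on `dom t⁻¹` are ever used. -/
structure PartialMaps (G X : Type*) where
  dom : G → Set X
  act : G → X → X

/-- A continuous partial action of a topological group `G` on a topological space `X`:
`X_t` is the target of `homeo t`, and `α_t : X_{t⁻¹} → X_t` is `homeo t`. -/
structure PartialAction (G X : Type*) [Group G] [TopologicalSpace G] [TopologicalSpace X] where
  homeo : G → OpenPartialHomeomorph X X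
  source_eq : ∀ t, (homeo t).source = (homeo t⁻¹).target
  isOpen_germs : IsOpen {p : G × X | p.2 ∈ (homeo p.1⁻¹).target}
  continuousOn_act :
    ContinuousOn (fun p : G × X => homeo p.1 p.2) {p : G × X | p.2 ∈ (homeo p.1⁻¹).target}
  dom_one : (homeo 1).target = univ
  act_mul : ∀ s t x, x ∈ (homeo t).source → homeo t x ∈ (homeo s).source →
    x ∈ (homeo (s * t)).source ∧ homeo (s * t) x = homeo s (homeo t x)

namespace PartialAction

section

variable {G X : Type*} [Group G] [TopologicalSpace G] [TopologicalSpace X]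

/-- The sets `X_t` and the maps `α_t` of a partial action. -/
def toMaps (α : PartialAction G X) : PartialMaps G X where
  dom t := (α.homeo t).target
  act t x := α.homeo t x

/-- Partial transitivity: `X = ⋃_r X_{sr} ∩ X_{tr}` for all `s`, `t`. -/
def PartiallyTransitive (α : PartialAction G X) : Prop :=
  ∀ s t : G, ⋃ r : G, α.toMaps.dom (s * r) ∩ α.toMaps.dom (t * r) = univ

theorem mem_dom_one (α : PartialAction G X) (x : X) : x ∈ α.toMaps.dom 1 := by
  simp [toMaps, α.dom_one]

theorem act_mem (α : PartialAction G X) {t : G} {x : X} (hx : x ∈ α.toMaps.dom t⁻¹) :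
    α.toMaps.act t x ∈ α.toMaps.dom t :=
  (α.homeo t).map_source (by rw [α.source_eq]; exact hx)

theorem act_comp (α : PartialAction G X) {s t : G} {x : X} (hx : x ∈ α.toMaps.dom t⁻¹)
    (hy : α.toMaps.act t x ∈ α.toMaps.dom s⁻¹) :
    x ∈ α.toMaps.dom (s * t)⁻¹ ∧
      α.toMaps.act (s * t) x = α.toMaps.act s (α.toMaps.act t x) := by
  have h := α.act_mul s t x (by rw [α.source_eq]; exact hx) (by rw [α.source_eq]; exact hy)
  rw [α.source_eq] at h
  exact h

theorem act_one (α : PartialAction G X) (x : X) : α.toMaps.act 1 x = x := by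
  have h1 : ∀ y : X, y ∈ α.toMaps.dom (1 : G)⁻¹ := fun y => by
    rw [inv_one]; exact α.mem_dom_one y
  have h := (α.act_comp (h1 x) (h1 _)).2
  rw [mul_one] at h
  refine (α.homeo 1).injOn ?_ ?_ h.symm <;> rw [α.source_eq] <;> exact h1 _

theorem act_inv_act (α : PartialAction G X) {t : G} {x : X} (hx : x ∈ α.toMaps.dom t⁻¹) :
    α.toMaps.act t⁻¹ (α.toMaps.act t x) = x := by
  have h := (α.act_comp (s := t⁻¹) hx (by rw [inv_inv]; exact α.act_mem hx)).2
  rw [inv_mul_cancel, act_one] at h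
  exact h.symm

/-! ### The enveloping action -/

/-- `(x, r) ∼ (y, s)` iff `x ∈ X_{r⁻¹s}` and `α_{s⁻¹r}(x) = y`. -/
def envSetoid (α : PartialAction G X) : Setoid (X × G) where
  r p q := p.1 ∈ α.toMaps.dom (p.2⁻¹ * q.2) ∧ α.toMaps.act (q.2⁻¹ * p.2) p.1 = q.1
  iseqv := by
    refine ⟨?_, ?_, ?_⟩
    · rintro ⟨x, r⟩
      simp only [inv_mul_cancel]
      exact ⟨α.mem_dom_one x, α.act_one x⟩
    · rintro ⟨x, r⟩ ⟨y, s⟩ ⟨h1, h2⟩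
      dsimp only at h1 h2 ⊢
      have h1' : x ∈ α.toMaps.dom (s⁻¹ * r)⁻¹ := by simpa using h1
      subst h2
      refine ⟨α.act_mem h1', ?_⟩
      have h := α.act_inv_act h1'
      simpa using h
    · rintro ⟨x, r⟩ ⟨y, s⟩ ⟨z, u⟩ ⟨h1, h2⟩ ⟨h3, h4⟩
      dsimp only at h1 h2 h3 h4 ⊢
      have h1' : x ∈ α.toMaps.dom (s⁻¹ * r)⁻¹ := by simpa using h1
      subst h2
      have h3' : α.toMaps.act (s⁻¹ * r) x ∈ α.toMaps.dom (u⁻¹ * s)⁻¹ := by simpa using h3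
      have h := α.act_comp h1' h3'
      have e : u⁻¹ * s * (s⁻¹ * r) = u⁻¹ * r := by group
      rw [e] at h
      refine ⟨by simpa using h.1, h.2.trans h4⟩

/-- The enveloping space `X^e = (X × G)/∼`. -/
def Envelope (α : PartialAction G X) : Type _ := Quotient α.envSetoid

/-- The class `[x, t]`. -/
def toEnvelope (α : PartialAction G X) (x : X) (t : G) : α.Envelope :=
  Quotient.mk α.envSetoid (x, t)

/-- The embedding `ι : X → X^e`, `ι(x) = [x, e]`. -/
def ι (α : PartialAction G X) (x : X) : α.Envelope := α.toEnvelope x 1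

/-- The quotient topology. -/
instance (α : PartialAction G X) : TopologicalSpace α.Envelope :=
  inferInstanceAs (TopologicalSpace (Quotient α.envSetoid))

/-- The Borel structure of the quotient topology. -/
instance (α : PartialAction G X) : MeasurableSpace α.Envelope := borel _

/-- The enveloping action `s • [x, t] = [x, st]`. -/
instance (α : PartialAction G X) : MulAction G α.Envelope where
  smul s := Quotient.map (fun p : X × G => (p.1, s * p.2)) (by
    rintro ⟨x, r⟩ ⟨y, t⟩ ⟨h1, h2⟩
    refine ⟨?_, ?_⟩
    · simpa [mul_assoc] using h1
    · simpa [mul_assoc] using h2)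
  one_smul := by
    rintro ⟨x, r⟩
    exact congrArg (Quotient.mk α.envSetoid) (by simp)
  mul_smul := by
    rintro s t ⟨x, r⟩
    exact congrArg (Quotient.mk α.envSetoid) (by simp [mul_assoc])

theorem smul_toEnvelope (α : PartialAction G X) (s : G) (x : X) (t : G) :
    s • α.toEnvelope x t = α.toEnvelope x (s * t) := rfl

/-- The enveloping action as a family of (everywhere defined) maps. -/
def envelopeMaps (α : PartialAction G X) : PartialMaps G α.Envelope where
  dom _ := univ
  act s z := s • z

/-! ### The quotient `Y = X/≈` -/

/-- `y ≈ y'` iff `[y, r] = [y', r']` for some `r`, `r'` in `G`. -/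
def orbitSetoid (α : PartialAction G X) : Setoid X where
  r y y' := ∃ r r' : G, α.toEnvelope y r = α.toEnvelope y' r'
  iseqv := by
    refine ⟨fun y => ⟨1, 1, rfl⟩, ?_, ?_⟩
    · rintro y y' ⟨r, r', h⟩
      exact ⟨r', r, h.symm⟩
    · rintro y y' y'' ⟨r, r', h⟩ ⟨s, s', h'⟩
      refine ⟨r, r' * s⁻¹ * s', h.trans ?_⟩
      have := congrArg (fun z => (r' * s⁻¹) • z) h'
      simpa [smul_toEnvelope] using this

/-- The quotient `Y = X/≈`. -/
def OrbitSpace (α : PartialAction G X) : Type _ := Quotient α.orbitSetoid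

/-- The quotient map `p : X → Y`. -/
def toOrbit (α : PartialAction G X) (x : X) : α.OrbitSpace := Quotient.mk α.orbitSetoid x

/-- The quotient Borel structure: `B ⊆ Y` is measurable iff its preimage in `X` is. -/
instance [MeasurableSpace X] (α : PartialAction G X) : MeasurableSpace α.OrbitSpace :=
  inferInstanceAs (MeasurableSpace (Quotient α.orbitSetoid))

open Classical in
/-- The maps induced on `Y`: `Y_t = p(X_t)` and `[y] ↦ [α_t(y)]` for `y ∈ X_{t⁻¹}`. -/
noncomputable def orbitMaps (α : PartialAction G X) : PartialMaps G α.OrbitSpace where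
  dom t := α.toOrbit '' α.toMaps.dom t
  act t y := if h : ∃ x ∈ α.toMaps.dom t⁻¹, α.toOrbit x = y
    then α.toOrbit (α.toMaps.act t h.choose) else y

theorem toOrbit_act (α : PartialAction G X) {t : G} {x : X} (hx : x ∈ α.toMaps.dom t⁻¹) :
    α.toOrbit (α.toMaps.act t x) = α.toOrbit x := by
  refine Quotient.sound (s := α.orbitSetoid) ⟨1, t, ?_⟩
  refine Quotient.sound (s := α.envSetoid) ⟨?_, ?_⟩
  · simpa using α.act_mem hx
  · simpa using α.act_inv_act hx

/-- The defining formula of the induced maps, independently of the representative. -/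
theorem orbitMaps_act (α : PartialAction G X) {t : G} {x : X} (hx : x ∈ α.toMaps.dom t⁻¹) :
    α.orbitMaps.act t (α.toOrbit x) = α.toOrbit (α.toMaps.act t x) := by
  have h : ∃ x' ∈ α.toMaps.dom t⁻¹, α.toOrbit x' = α.toOrbit x := ⟨x, hx, rfl⟩
  simp only [orbitMaps, dif_pos h]
  rw [α.toOrbit_act h.choose_spec.1, α.toOrbit_act hx, h.choose_spec.2]

end

end PartialAction

/-! ### Zimmer amenability -/

/-- The closed unit ball `E^*_1` of the dual of `E`, with the weak-* topology. -/
def DualBall (𝕜 E : Type*) [RCLike 𝕜] [NormedAddCommGroup E] [NormedSpace 𝕜 E] : Type _ :=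
  {φ : WeakDual 𝕜 E // ‖WeakDual.toStrongDual φ‖ ≤ 1}

namespace DualBall

section

variable {𝕜 E : Type*} [RCLike 𝕜] [NormedAddCommGroup E] [NormedSpace 𝕜 E]

instance : TopologicalSpace (DualBall 𝕜 E) :=
  inferInstanceAs (TopologicalSpace {φ : WeakDual 𝕜 E // ‖WeakDual.toStrongDual φ‖ ≤ 1})

instance : MeasurableSpace (DualBall 𝕜 E) := borel _

/-- A convex subset of the dual ball. -/
def IsConvex (A : Set (DualBall 𝕜 E)) : Prop :=
  ∀ φ ∈ A, ∀ ψ ∈ A, ∀ a b : ℝ, 0 ≤ a → 0 ≤ b → a + b = 1 →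
    ∃ χ ∈ A, χ.val = (a : 𝕜) • φ.val + (b : 𝕜) • ψ.val

/-- `(T⁻¹)^*` on the dual ball: `φ ↦ φ ∘ T⁻¹`. -/
noncomputable def invAdjoint (T : E ≃ₗᵢ[𝕜] E) (φ : DualBall 𝕜 E) : DualBall 𝕜 E :=
  ⟨StrongDual.toWeakDual ((WeakDual.toStrongDual φ.val).comp
      (T⁻¹ : E ≃ₗᵢ[𝕜] E).toContinuousLinearEquiv.toContinuousLinearMap), by
    refine ContinuousLinearMap.opNorm_le_bound _ zero_le_one fun x => ?_
    refine ((WeakDual.toStrongDual φ.val).le_of_opNorm_le φ.property _).trans ?_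
    exact le_of_eq (congrArg (fun c : ℝ => 1 * c) ((T⁻¹ : E ≃ₗᵢ[𝕜] E).norm_map x))⟩

theorem invAdjoint_apply (T : E ≃ₗᵢ[𝕜] E) (φ : DualBall 𝕜 E) (x : E) :
    (invAdjoint T φ).val x = φ.val (T⁻¹ x) := rfl

end

end DualBall

/-- The Borel structure of the strong operator topology on `Iso(E)`. -/
abbrev isoBorel (𝕜 E : Type*) [RCLike 𝕜] [NormedAddCommGroup E] [NormedSpace 𝕜 E] :
    MeasurableSpace (E ≃ₗᵢ[𝕜] E) :=
  @borel _ (TopologicalSpace.induced (fun (T : E ≃ₗᵢ[𝕜] E) (x : E) => T x) inferInstance)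

namespace PartialMaps

/-- Quasi-invariance: `ν(E) = 0` implies `ν(α_s(E)) = 0` for Borel `E ⊆ X_{s⁻¹}`. -/
def QuasiInvariant {G X : Type*} [Group G] [MeasurableSpace X] (α : PartialMaps G X)
    (ν : Measure X) : Prop :=
  ∀ (s : G) (E : Set X), MeasurableSet E → E ⊆ α.dom s⁻¹ → ν E = 0 → ν (α.act s '' E) = 0

/-- `{(x, s) : x ∈ X_{s⁻¹}}`. -/
def germs {G X : Type*} [Group G] (α : PartialMaps G X) : Set (X × G) :=
  {p | p.1 ∈ α.dom p.2⁻¹}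

/-- `σ` is a partial 2-cocycle `X ⋊_α G → Iso(E)`: it is Borel on the set of `(x, s)` with
`x ∈ X_{s⁻¹}` (values elsewhere are irrelevant), and `σ(x, ts) = σ(x, s) σ(α_s(x), t)`. -/
structure IsCocycle (𝕜 : Type*) {G X E : Type*} [Group G] [MeasurableSpace G]
    [MeasurableSpace X] [RCLike 𝕜] [NormedAddCommGroup E] [NormedSpace 𝕜 E]
    (α : PartialMaps G X) (σ : X × G → (E ≃ₗᵢ[𝕜] E)) : Prop where
  borel : Measurable[inferInstance, isoBorel 𝕜 E] (fun p : α.germs => σ p.1)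
  mul : ∀ (s t : G) (x : X), x ∈ α.dom s⁻¹ → α.act s x ∈ α.dom t⁻¹ → x ∈ α.dom (t * s)⁻¹ →
    σ (x, t * s) = σ (x, s) * σ (α.act s x, t)

/-- `A` is a `σ`-invariant Borel field of non-empty compact convex subsets of `E^*_1`. -/
structure IsInvariantField {𝕜 G X E : Type*} [Group G]
    [MeasurableSpace X] [RCLike 𝕜] [NormedAddCommGroup E] [NormedSpace 𝕜 E]
    (α : PartialMaps G X) (ν : Measure X) (σ : X × G → (E ≃ₗᵢ[𝕜] E))
    (A : X → Set (DualBall 𝕜 E)) : Prop where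
  nonempty : ∀ x, (A x).Nonempty
  compact : ∀ x, IsCompact (A x)
  convex : ∀ x, DualBall.IsConvex (A x)
  borel : MeasurableSet {p : X × DualBall 𝕜 E | p.2 ∈ A p.1}
  invariant : ∀ s : G, ∀ᵐ x ∂ν, x ∈ α.dom s⁻¹ →
    DualBall.invAdjoint (σ (x, s)) '' A (α.act s x) = A x

/-- `η : X → E^*_1` is a `σ`-invariant Borel section of the field `A`. -/
structure IsInvariantSection {𝕜 G X E : Type*} [Group G]
    [MeasurableSpace X] [RCLike 𝕜] [NormedAddCommGroup E] [NormedSpace 𝕜 E]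
    (α : PartialMaps G X) (ν : Measure X) (σ : X × G → (E ≃ₗᵢ[𝕜] E))
    (A : X → Set (DualBall 𝕜 E)) (η : X → DualBall 𝕜 E) : Prop where
  borel : Measurable η
  mem : ∀ᵐ x ∂ν, η x ∈ A x
  invariant : ∀ s : G, ∀ᵐ x ∂ν, x ∈ α.dom s⁻¹ →
    DualBall.invAdjoint (σ (x, s)) (η (α.act s x)) = η x

/-- Amenability in the sense of Zimmer, with respect to the measure (class of) `ν`: for every
separable Banach space `E` over `𝕜`, every partial 2-cocycle `σ` with values in `Iso(E)` and
every `σ`-invariant Borel field in `E^*_1` there is a `σ`-invariant Borel section. -/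
def ZimmerAmenable (𝕜 : Type) [RCLike 𝕜] {G X : Type u} [Group G] [MeasurableSpace G]
    [MeasurableSpace X] (α : PartialMaps G X) (ν : Measure X) : Prop :=
  ∀ (E : Type u) [NormedAddCommGroup E] [NormedSpace 𝕜 E] [CompleteSpace E]
    [TopologicalSpace.SeparableSpace E] (σ : X × G → (E ≃ₗᵢ[𝕜] E))
    (A : X → Set (DualBall 𝕜 E)), α.IsCocycle 𝕜 σ → α.IsInvariantField ν σ A →
    ∃ η : X → DualBall 𝕜 E, α.IsInvariantSection ν σ A η

end PartialMaps

/-!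
Both halves compare cocycles and invariant fields on `X`, on its envelope `X^e` and on `Y = X/≈`.

From `X^e` to `X` (`PartialAction.zimmerAmenable_of_envelope`). Countably many translates of the
open set `ι(X)` cover `X^e`, so there is a Borel way of writing `z = d(z) • ι(π z)`, with `d = 1` on
`ι(X)` (`PartialAction.exists_chart`). Since `s • z = d(sz) • ι(π(sz))`, the element
`d(sz)⁻¹ s d(z)` moves `π z` to `π(sz)` under the partial action. A partial cocycle `σ` on
`X` therefore gives the cocycle `σ(π z, d(sz)⁻¹ s d(z))` on `X^e`, a field `A` gives the field
`A (π z)`, and an invariant section over `X^e` restricts to one over `X`.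

From `Y` to `X^e` (`PartialAction.envelope_zimmerAmenable_of_orbit`). The induced maps of `Y` are
restrictions of the identity. Given `σ` and `A` on `X^e`, let `μ` be a finite measure equivalent to
`ν^e`, and let `G` act on `L¹(μ; E)` by the regular representation twisted by `σ` and by the
densities of the translates of `μ` (`regularRep`). It is isometric, and strongly continuous because
it is measurable (`continuous_of_measurable_isometric`), so it is a cocycle on `Y` which does not
depend on the point. The corresponding constant field is the set of the functionals
`f ↦ ∫ φ_z(f(z)) dμ(z)`, where `φ` is a measurable section of `A` (`DualBall.sectionFunctionals`).
It is

* non-empty, by the von Neumann selection theorem, of which only an almost everywhere version is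
  needed (`exists_measurable_rightInverse_ae`);
* weak-* compact and convex, since it is cut out by the half spaces
  `Re Φ(1_B x) ≤ ∫_B h_{A z}(x) dμ(z)`, where `h` is the support function
  (`DualBall.IsBorelField.mem_sectionFunctionals_iff`): the measures `B ↦ Re Φ(1_B x)` have
  densities, and these assemble to a section of `A` by the Hahn–Banach theorem;
* invariant, as `A` is invariant (`invAdjoint_regularRep_image_sectionFunctionals`).

Amenability of `Y` gives a field of such functionals over `Y`. At the class of a generic `x`, the
functional `Φ` is fixed by a dense set of the `s` with `x ∈ X_{s⁻¹}`, and then by all of them by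
strong continuity. Partial transitivity says that every `g` is of the form `(g r) r⁻¹` with `x` in
`X_{gr}` and in `X_r`, so `Φ` is fixed by `G`. The section of `A` behind `Φ` is then invariant.
-/

/-! ### Measurable selection almost everywhere -/

section Selection

open Filter Topology

theorem isCompact_setOf_forall_le (b : ℕ → ℕ) : IsCompact {x : ℕ → ℕ | ∀ i, x i ≤ b i} := by
  have h := isCompact_univ_pi (s := fun i => Iic (b i)) fun i => (finite_Iic (b i)).isCompact
  convert h using 1
  ext x
  simp only [mem_univ_pi, mem_Iic]
  rfl

/-- An open set which contains the compact box of all sequences bounded by `b` already contains the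
sequences satisfying finitely many of these bounds. -/
theorem exists_subset_of_isOpen_of_forall_le {b : ℕ → ℕ} {V : Set (ℕ → ℕ)} (hV : IsOpen V)
    (hb : {x : ℕ → ℕ | ∀ i, x i ≤ b i} ⊆ V) : ∃ n, {x : ℕ → ℕ | ∀ i < n, x i ≤ b i} ⊆ V := by
  by_contra! hcon
  have hx : ∀ n, ∃ x : ℕ → ℕ, (∀ i < n, x i ≤ b i) ∧ x ∉ V := fun n => by
    obtain ⟨x, hx, hxV⟩ := not_subset.1 (hcon n)
    exact ⟨x, hx, hxV⟩
  choose x hxb hxV using hx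
  -- truncating the `x n` gives points of the compact set which have the same limit points
  obtain ⟨y, hy, φ, hφ, hlim⟩ := (isCompact_setOf_forall_le b).tendsto_subseq
    (x := fun n i => min (x n i) (b i)) fun n i => min_le_right _ _
  have hlim' : Tendsto (x ∘ φ) atTop (𝓝 y) := by
    rw [tendsto_pi_nhds] at hlim ⊢
    intro i
    refine (hlim i).congr' ?_
    filter_upwards [eventually_gt_atTop i] with n hn
    exact min_eq_left (hxb _ i (hn.trans_le (hφ.id_le n)))
  obtain ⟨n, hn⟩ := (hlim'.eventually (hV.mem_nhds (hb hy))).exists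
  exact hxV _ hn

/-- The capacitability argument: the outer measure of a continuous image of Baire space is
approximated by the images of compact sets. -/
theorem exists_isCompact_lt_measure_image {Z : Type*} [TopologicalSpace Z]
    [MeasurableSpace Z] (μ : Measure Z) [μ.OuterRegular] {F : (ℕ → ℕ) → Z}
    (hF : Continuous F) {c : ENNReal} (hc : c < μ (range F)) :
    ∃ L : Set (ℕ → ℕ), IsCompact L ∧ c ≤ μ (F '' L) := by
  -- the `n`-th coordinate can be bounded without bringing the outer measure down to `c`
  have step : ∀ (n : ℕ) (C : Set (ℕ → ℕ)), c < μ (F '' C) →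
      ∃ k, c < μ (F '' (C ∩ {x | x n ≤ k})) := by
    intro n C hC
    have hU : F '' C = ⋃ k, F '' (C ∩ {x | x n ≤ k}) := by
      rw [← image_iUnion, ← inter_iUnion]
      congr 1
      rw [eq_comm, inter_eq_left]
      exact fun x _ => mem_iUnion.2 ⟨x n, le_refl (x n)⟩
    have hmono : Monotone fun k => F '' (C ∩ {x : ℕ → ℕ | x n ≤ k}) := fun k l hkl =>
      image_mono (inter_subset_inter_right _ fun x (hx : x n ≤ k) => hx.trans hkl)
    rw [hU, hmono.measure_iUnion, lt_iSup_iff] at hC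
    exact hC
  choose! k hk using step
  let S : ℕ → {C : Set (ℕ → ℕ) // c < μ (F '' C)} := fun n => Nat.rec
    ⟨univ, by rwa [image_univ]⟩ (fun n C => ⟨_, hk n C.1 C.2⟩) n
  let b : ℕ → ℕ := fun n => k n (S n).1
  have hS : ∀ n, (S n).1 = {x | ∀ i < n, x i ≤ b i} := by
    intro n
    induction n with
    | zero => simp [S]
    | succ n ih =>
      change (S n).1 ∩ {x | x n ≤ b n} = _
      rw [ih]
      ext x
      simp only [mem_inter_iff, mem_ofPred_eq, Nat.lt_succ_iff_lt_or_eq]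
      constructor
      · rintro ⟨h1, h2⟩ i (hi | rfl)
        exacts [h1 i hi, h2]
      · exact fun h => ⟨fun i hi => h i (Or.inl hi), h n (Or.inr rfl)⟩
  refine ⟨{x | ∀ i, x i ≤ b i}, isCompact_setOf_forall_le b, ?_⟩
  -- an open neighbourhood of the image of the box contains the image of some `S n`
  · rw [Set.measure_eq_iInf_isOpen]
    refine le_iInf₂ fun U hU => le_iInf fun hUo => ?_
    obtain ⟨n, hn⟩ := exists_subset_of_isOpen_of_forall_le (hUo.preimage hF)
      (b := b) (image_subset_iff.1 hU)
    rw [← hS] at hn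
    exact (S n).2.le.trans (measure_mono (image_subset_iff.2 hn))

/-- The lexicographically least element of a non-empty closed subset of Baire space. On other sets
the value is irrelevant. -/
noncomputable def leastBranch (S : Set (ℕ → ℕ)) (n : ℕ) : ℕ :=
  sInf {k | ∃ x ∈ S, (∀ (i : ℕ) (_ : i < n), x i = leastBranch S i) ∧ x n = k}
termination_by n

theorem leastBranch_mem {S : Set (ℕ → ℕ)} (hS : IsClosed S) (hne : S.Nonempty) :
    leastBranch S ∈ S := by
  have h : ∀ n, ∃ x ∈ S, ∀ i < n, x i = leastBranch S i := by
    intro n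
    induction n with
    | zero => exact hne.imp fun x hx => ⟨hx, fun i hi => absurd hi (Nat.not_lt_zero i)⟩
    | succ n ih =>
      obtain ⟨x, hx, hxi⟩ := ih
      have hmem : leastBranch S n ∈
          {k | ∃ x ∈ S, (∀ (i : ℕ) (_ : i < n), x i = leastBranch S i) ∧ x n = k} := by
        rw [leastBranch]
        exact Nat.sInf_mem ⟨x n, x, hx, hxi, rfl⟩
      obtain ⟨y, hy, hyi, hyn⟩ := hmem
      refine ⟨y, hy, fun i hi => ?_⟩
      rcases Nat.lt_succ_iff_lt_or_eq.1 hi with hi | rfl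
      exacts [hyi i hi, hyn]
  choose x hxS hxi using h
  refine hS.mem_of_tendsto (f := x) (b := atTop) (tendsto_pi_nhds.2 fun i => ?_)
    (Eventually.of_forall hxS)
  refine tendsto_const_nhds.congr' ?_
  filter_upwards [eventually_gt_atTop i] with n hn
  exact (hxi n i hn).symm

theorem measurable_nat_sInf {Z : Type*} [MeasurableSpace Z] {K : Z → Set ℕ}
    (hK : ∀ k, MeasurableSet {z | k ∈ K z}) : Measurable fun z => sInf (K z) := by
  refine measurable_to_countable' fun k => ?_
  -- the second set of the union accounts for `sInf ∅ = 0`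
  have h : (fun z => sInf (K z)) ⁻¹' {k} =
      ({z | k ∈ K z} ∩ ⋂ j < k, {z | j ∈ K z}ᶜ) ∪
        ({z | k = 0} ∩ ⋂ j : ℕ, {z | j ∈ K z}ᶜ) := by
    ext z
    simp only [mem_preimage, mem_singleton_iff, mem_union, mem_inter_iff, mem_iInter,
      mem_compl_iff, mem_ofPred_eq]
    constructor
    · rintro rfl
      rcases (K z).eq_empty_or_nonempty with h | h
      · exact Or.inr ⟨by simp [h], by simp [h]⟩
      · exact Or.inl ⟨Nat.sInf_mem h, fun j hj => Nat.notMem_of_lt_sInf hj⟩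
    · rintro (⟨h1, h2⟩ | ⟨rfl, h2⟩)
      · exact le_antisymm (Nat.sInf_le h1) (not_lt.1 fun h => h2 _ h (Nat.sInf_mem ⟨k, h1⟩))
      · simp [eq_empty_of_forall_notMem h2]
  rw [h]
  exact ((hK k).inter (.biInter (to_countable _) fun j _ => (hK j).compl)).union
    ((MeasurableSet.const _).inter (.iInter fun j => (hK j).compl))

/-- The least point of the fibre `L ∩ F⁻¹(z)` depends measurably on `z`: its `n`-th coordinate is
the least `k` such that `z ∈ F(L ∩ C)`, where the cylinder `C` fixes the earlier coordinates and
`x n = k`, and each `F(L ∩ C)` is compact. -/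
theorem measurable_leastBranch {Z : Type*} [TopologicalSpace Z] [T2Space Z] [MeasurableSpace Z]
    [OpensMeasurableSpace Z] {F : (ℕ → ℕ) → Z} (hF : Continuous F) {L : Set (ℕ → ℕ)}
    (hL : IsCompact L) : Measurable fun z => leastBranch (L ∩ F ⁻¹' {z}) := by
  refine measurable_pi_lambda _ fun n => ?_
  induction n using Nat.strong_induction_on with
  | _ n ih =>
    have hdef : (fun z => leastBranch (L ∩ F ⁻¹' {z}) n) = fun z => sInf {k |
        ∃ x ∈ L ∩ F ⁻¹' {z}, (∀ (i : ℕ) (_ : i < n), x i = leastBranch (L ∩ F ⁻¹' {z}) i) ∧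
          x n = k} := by
      funext z
      rw [leastBranch]
    rw [hdef]
    refine measurable_nat_sInf fun k => ?_
    have h : {z | k ∈ {k | ∃ x ∈ L ∩ F ⁻¹' {z},
        (∀ (i : ℕ) (_ : i < n), x i = leastBranch (L ∩ F ⁻¹' {z}) i) ∧ x n = k}} =
        ⋃ s : Fin n → ℕ, (⋂ i : Fin n, {z | leastBranch (L ∩ F ⁻¹' {z}) i = s i}) ∩
          F '' (L ∩ ((⋂ i : Fin n, {x | x i = s i}) ∩ {x | x n = k})) := by
      ext z
      simp only [mem_ofPred_eq, mem_iUnion, mem_inter_iff, mem_iInter, mem_image, mem_preimage,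
        mem_singleton_iff]
      constructor
      · rintro ⟨x, ⟨hxL, hxz⟩, hx, hxn⟩
        exact ⟨fun i => x i, fun i => (hx i i.2).symm, x, ⟨hxL, fun i => rfl, hxn⟩, hxz⟩
      · rintro ⟨s, hs, x, ⟨hxL, hx, hxn⟩, hxz⟩
        exact ⟨x, ⟨hxL, hxz⟩, fun i hi => (hx ⟨i, hi⟩).trans (hs ⟨i, hi⟩).symm, hxn⟩
    rw [h]
    refine .iUnion fun s => .inter (.iInter fun i => ?_) (IsCompact.measurableSet ?_)
    · exact ih i i.2 (measurableSet_singleton (s i))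
    · refine (hL.inter_right (.inter (isClosed_iInter fun i => ?_) ?_)).image hF
      · exact isClosed_eq (continuous_apply _) continuous_const
      · exact isClosed_eq (continuous_apply _) continuous_const

/-- The von Neumann selection theorem, almost everywhere: a measurable map between standard Borel
spaces has a measurable right inverse on a measurable set which exhausts its range up to a null
set. -/
theorem exists_measurable_rightInverse_ae {W Z : Type*} [MeasurableSpace W] [StandardBorelSpace W]
    [Nonempty W] [MeasurableSpace Z] [StandardBorelSpace Z] (μ : Measure Z) [IsFiniteMeasure μ]
    {f : W → Z} (hf : Measurable f) :
    ∃ (T : Set Z) (h : Z → W), MeasurableSet T ∧ T ⊆ range f ∧ μ (range f \ T) = 0 ∧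
      Measurable h ∧ ∀ z ∈ T, f (h z) = z := by
  -- `f` becomes continuous for a finer Polish topology on `W` with the same Borel sets, and then
  -- `W` is a continuous image of Baire space
  let := upgradeStandardBorel Z
  let := upgradeStandardBorel W
  obtain ⟨t', ht', hft', hp⟩ := hf.exists_continuous
  obtain ⟨g, hg, hgs⟩ := @PolishSpace.exists_nat_nat_continuous_surjective W t' hp _
  have hgm : Measurable g := @Continuous.measurable _ _ _ _ _ t' _ ⟨
    (eq_borel_upgradeStandardBorel W).trans
      (borel_eq_borel_of_le hp this.toPolishSpace ht').symm⟩ _ hg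
  have hF : Continuous (f ∘ g) := @Continuous.comp _ _ _ _ t' _ _ _ hft' hg
  have hr : range (f ∘ g) = range f := hgs.range_comp f
  rcases eq_or_ne (μ (range f)) 0 with h0 | h0
  · exact ⟨∅, fun _ => Classical.arbitrary W, .empty, empty_subset _, by simpa using h0,
      measurable_const, fun z hz => hz.elim⟩
  obtain ⟨u, -, hu, hlim⟩ := exists_seq_strictMono_tendsto' (pos_iff_ne_zero.2 h0)
  have hL : ∀ n, ∃ L : Set (ℕ → ℕ), IsCompact L ∧ u n ≤ μ (f ∘ g '' L) := fun n =>
    exists_isCompact_lt_measure_image μ hF (by rw [hr]; exact (hu n).2)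
  choose L hLc hLu using hL
  let T : ℕ → Set Z := fun n => f ∘ g '' L n
  have hTm : ∀ n, MeasurableSet (T n) := fun n => ((hLc n).image hF).measurableSet
  have hTr : ⋃ n, T n ⊆ range f := iUnion_subset fun n => hr ▸ image_subset_range _ _
  obtain ⟨h, hhm, hh⟩ := exists_measurable_piecewise (disjointed T)
    (.disjointed hTm) (fun n z => g (leastBranch (L n ∩ f ∘ g ⁻¹' {z})))
    (fun n => hgm.comp (measurable_leastBranch hF (hLc n)))
    (fun m n hmn z hz => absurd hz (by
      rw [((disjoint_disjointed T) hmn).inter_eq]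
      exact notMem_empty z))
  refine ⟨⋃ n, T n, h, .iUnion hTm, hTr, ?_, hhm, fun z hz => ?_⟩
  · have h1 : μ (range f) ≤ μ (⋃ n, T n) := le_of_tendsto' hlim fun n =>
      (hLu n).trans (measure_mono (subset_iUnion T n))
    rw [measure_sdiff hTr (MeasurableSet.iUnion hTm).nullMeasurableSet (measure_ne_top _ _)]
    exact tsub_eq_zero_of_le h1
  · rw [← iUnion_disjointed] at hz
    obtain ⟨n, hn⟩ := mem_iUnion.1 hz
    rw [hh n hn]
    obtain ⟨x, hxL, hxz⟩ := disjointed_subset T n hn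
    exact (leastBranch_mem ((hLc n).isClosed.inter (isClosed_singleton.preimage hF))
      ⟨x, hxL, hxz⟩).2

/-- Projections of Borel sets are universally measurable. -/
theorem nullMeasurableSet_range {W Z : Type*} [MeasurableSpace W] [StandardBorelSpace W]
    [MeasurableSpace Z] [StandardBorelSpace Z] (μ : Measure Z) [IsFiniteMeasure μ]
    {f : W → Z} (hf : Measurable f) : NullMeasurableSet (range f) μ := by
  rcases isEmpty_or_nonempty W with hW | hW
  · rw [range_eq_empty]
    exact .empty
  obtain ⟨T, -, hT, hTr, hT0, -⟩ := exists_measurable_rightInverse_ae μ hf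
  rw [← union_sdiff_cancel hTr]
  exact hT.nullMeasurableSet.union (.of_null hT0)

end Selection

/-! ### The dual ball -/

section DenseSubgroup

variable (E : Type*) [NormedAddCommGroup E] [TopologicalSpace.SeparableSpace E]

/-- A countable dense additive subgroup of a separable normed space: the integral combinations of
a dense sequence. -/
noncomputable def denseSubgroup : AddSubgroup E :=
  (Finsupp.linearCombination ℤ (TopologicalSpace.denseSeq E)).toAddMonoidHom.range

instance countable_denseSubgroup : Countable (denseSubgroup E) :=
  (countable_range (Finsupp.linearCombination ℤ (TopologicalSpace.denseSeq E))).to_subtype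

theorem dense_denseSubgroup : Dense (denseSubgroup E : Set E) :=
  (TopologicalSpace.denseRange_denseSeq E).mono <| range_subset_iff.2 fun n =>
    ⟨Finsupp.single n 1, by simp⟩

end DenseSubgroup

namespace DualBall

open Filter Topology

section

variable {𝕜 E : Type*} [RCLike 𝕜] [NormedAddCommGroup E] [NormedSpace 𝕜 E]

theorem norm_apply_le (φ : DualBall 𝕜 E) (x : E) : ‖φ.val x‖ ≤ ‖x‖ := by
  simpa using (WeakDual.toStrongDual φ.val).le_of_opNorm_le φ.property x

/-- The real part of the evaluation of `φ` at `x`. -/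
noncomputable def reEval (φ : DualBall 𝕜 E) (x : E) : ℝ := RCLike.re (φ.val x)

theorem reEval_add (φ : DualBall 𝕜 E) (x y : E) : φ.reEval (x + y) = φ.reEval x + φ.reEval y := by
  simp [reEval]

theorem reEval_sub (φ : DualBall 𝕜 E) (x y : E) : φ.reEval (x - y) = φ.reEval x - φ.reEval y := by
  simp [reEval]

theorem abs_reEval_le (φ : DualBall 𝕜 E) (x : E) : |φ.reEval x| ≤ ‖x‖ :=
  (RCLike.abs_re_le_norm _).trans (φ.norm_apply_le x)

theorem continuous_eval (x : E) : Continuous fun φ : DualBall 𝕜 E => φ.val x :=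
  (WeakDual.eval_continuous x).comp continuous_subtype_val

theorem continuous_reEval_left (x : E) : Continuous fun φ : DualBall 𝕜 E => φ.reEval x :=
  RCLike.continuous_re.comp (continuous_eval x)

theorem continuous_reEval (φ : DualBall 𝕜 E) : Continuous φ.reEval :=
  RCLike.continuous_re.comp (WeakDual.toStrongDual φ.val).continuous

theorem ext_of_apply {φ ψ : DualBall 𝕜 E} (h : ∀ x, φ.val x = ψ.val x) : φ = ψ :=
  Subtype.ext (DFunLike.ext _ _ h)

/-- A functional is determined by its real part, since `Im φ(x) = -Re φ(ix)`. -/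
theorem ext_of_reEval {φ ψ : DualBall 𝕜 E} (h : ∀ x, φ.reEval x = ψ.reEval x) : φ = ψ := by
  refine ext_of_apply fun x => RCLike.ext (h x) ?_
  have hI : ∀ χ : DualBall 𝕜 E, RCLike.im (χ.val x) =
      -(RCLike.im (RCLike.I : 𝕜) * χ.reEval ((RCLike.I : 𝕜) • x)) := by
    intro χ
    simp only [reEval, map_smul, smul_eq_mul, RCLike.mul_re, RCLike.I_re, zero_mul, zero_sub]
    rcases RCLike.I_eq_zero_or_im_I_eq_one (K := 𝕜) with h0 | h1
    · have : RCLike.im (χ.val x) = 0 := by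
        have := RCLike.I_mul_I_ax (K := 𝕜)
        rw [← RCLike.re_add_im (χ.val x), h0]
        simp
      simp [this]
    · simp [h1]
  rw [hI φ, hI ψ, h]

theorem ext_of_dense {D : Set E} (hD : Dense D) {φ ψ : DualBall 𝕜 E}
    (h : ∀ x ∈ D, φ.reEval x = ψ.reEval x) : φ = ψ :=
  ext_of_reEval (congrFun (φ.continuous_reEval.ext_on hD ψ.continuous_reEval h))

instance : T2Space (DualBall 𝕜 E) :=
  inferInstanceAs (T2Space {φ : WeakDual 𝕜 E // ‖WeakDual.toStrongDual φ‖ ≤ 1})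

instance : CompactSpace (DualBall 𝕜 E) := by
  have h : IsCompact {φ : WeakDual 𝕜 E | ‖WeakDual.toStrongDual φ‖ ≤ 1} := by
    convert WeakDual.isCompact_closedBall (0 : StrongDual 𝕜 E) 1 using 1
    ext φ
    simp
  exact isCompact_iff_compactSpace.1 h

instance : BorelSpace (DualBall 𝕜 E) := ⟨rfl⟩

noncomputable instance : Inhabited (DualBall 𝕜 E) := ⟨⟨0, by simp⟩⟩

section Separable

variable [TopologicalSpace.SeparableSpace E]

theorem isClosedEmbedding_reEval :
    IsClosedEmbedding fun (φ : DualBall 𝕜 E) (x : denseSubgroup E) => φ.reEval x :=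
  (continuous_pi fun x : denseSubgroup E => continuous_reEval_left x.1).isClosedEmbedding
    fun _ _ h => ext_of_dense (dense_denseSubgroup E) fun x hx => congrFun h ⟨x, hx⟩

instance : PolishSpace (DualBall 𝕜 E) := isClosedEmbedding_reEval.polishSpace

theorem measurable_of_reEval {Z : Type*} [MeasurableSpace Z] {φ : Z → DualBall 𝕜 E}
    (h : ∀ x ∈ denseSubgroup E, Measurable fun z => (φ z).reEval x) : Measurable φ := by
  refine isClosedEmbedding_reEval.measurableEmbedding.measurable_comp_iff.1 ?_
  exact measurable_pi_lambda _ fun x => h x.1 x.2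

end Separable

/-- The support function `x ↦ sup {Re φ(x) : φ ∈ A}` of a set of functionals. The supremum is
bounded by `‖x‖`, so it is a true supremum as soon as `A` is non-empty. -/
noncomputable def support (A : Set (DualBall 𝕜 E)) (x : E) : ℝ :=
  sSup ((fun φ : DualBall 𝕜 E => φ.reEval x) '' A)

theorem bddAbove_reEval (A : Set (DualBall 𝕜 E)) (x : E) :
    BddAbove ((fun φ : DualBall 𝕜 E => φ.reEval x) '' A) :=
  ⟨‖x‖, forall_mem_image.2 fun φ _ => (le_abs_self _).trans (φ.abs_reEval_le x)⟩

theorem reEval_le_support {A : Set (DualBall 𝕜 E)} {φ : DualBall 𝕜 E} (h : φ ∈ A) (x : E) :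
    φ.reEval x ≤ support A x :=
  le_csSup (bddAbove_reEval A x) (mem_image_of_mem _ h)

theorem support_le {A : Set (DualBall 𝕜 E)} (hA : A.Nonempty) {x : E} {c : ℝ}
    (h : ∀ φ ∈ A, φ.reEval x ≤ c) : support A x ≤ c :=
  csSup_le (hA.image _) (forall_mem_image.2 h)

theorem abs_support_le {A : Set (DualBall 𝕜 E)} (hA : A.Nonempty) (x : E) :
    |support A x| ≤ ‖x‖ := by
  refine abs_le.2 ⟨?_, support_le hA fun φ _ => (le_abs_self _).trans (φ.abs_reEval_le x)⟩
  obtain ⟨φ, hφ⟩ := hA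
  exact (abs_le.1 (φ.abs_reEval_le x)).1.trans (reEval_le_support hφ x)

section Real

variable [NormedSpace ℝ E] [IsScalarTower ℝ 𝕜 E]

/-- The real part of a functional in the dual ball, as a point of the real weak dual. -/
noncomputable def reDual (φ : DualBall 𝕜 E) : WeakDual ℝ E :=
  StrongDual.toWeakDual
    (RCLike.reCLM.comp ((WeakDual.toStrongDual φ.val).restrictScalars ℝ))

theorem continuous_reDual : Continuous (reDual : DualBall 𝕜 E → WeakDual ℝ E) :=
  WeakDual.continuous_of_continuous_eval fun x => continuous_reEval_left x

/-- A real functional dominated by the support function of a compact convex set is the real part of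
a member of that set: otherwise Hahn–Banach separation in the weak-* topology gives an `x` at which
the support function is too small. -/
theorem exists_reEval_eq_of_le_support {A : Set (DualBall 𝕜 E)} (hA : A.Nonempty)
    (hc : IsCompact A) (hconv : IsConvex A) {g : StrongDual ℝ E}
    (hg : ∀ x, g x ≤ support A x) : ∃ φ ∈ A, ∀ x, φ.reEval x = g x := by
  by_contra! hcon
  have hconv' : Convex ℝ (reDual '' A) := by
    rintro _ ⟨φ, hφ, rfl⟩ _ ⟨ψ, hψ, rfl⟩ a b ha hb hab
    obtain ⟨χ, hχ, h⟩ := hconv φ hφ ψ hψ a b ha hb hab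
    refine ⟨χ, hχ, DFunLike.ext _ _ fun x => ?_⟩
    change RCLike.re (χ.val x) = a * RCLike.re (φ.val x) + b * RCLike.re (ψ.val x)
    rw [h]
    change RCLike.re ((a : 𝕜) * φ.val x + (b : 𝕜) * ψ.val x) = _
    simp
  have hcl : IsClosed (reDual '' A) := (hc.image continuous_reDual).isClosed
  have hg' : StrongDual.toWeakDual g ∉ reDual '' A := by
    rintro ⟨φ, hφ, h⟩
    obtain ⟨x, hx⟩ := hcon φ hφ
    exact hx (DFunLike.congr_fun h x)
  have : LocallyConvexSpace ℝ (WeakDual ℝ E) :=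
    (LinearMap.weakBilin_withSeminorms (topDualPairing ℝ E)).toLocallyConvexSpace
  obtain ⟨f, r, hf, hr⟩ := geometric_hahn_banach_closed_point hconv' hcl hg'
  obtain ⟨x, rfl⟩ := LinearMap.dualEmbedding_surjective (topDualPairing ℝ E) f
  have h1 : support A x ≤ r := support_le hA fun φ hφ => (hf _ (mem_image_of_mem _ hφ)).le
  have h2 : r < g x := hr
  exact absurd (hg x) (not_le.2 (h1.trans_lt h2))

end Real

theorem support_sub_le (A : Set (DualBall 𝕜 E)) (hA : A.Nonempty) (x y : E) :
    support A x - support A y ≤ ‖x - y‖ := by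
  rw [sub_le_iff_le_add]
  refine support_le hA fun φ hφ => ?_
  have h1 := (le_abs_self _).trans (φ.abs_reEval_le (x - y))
  have h2 := reEval_le_support hφ y
  rw [reEval_sub] at h1
  linarith

theorem lipschitzWith_support {A : Set (DualBall 𝕜 E)} (hA : A.Nonempty) :
    LipschitzWith 1 (support A) := by
  refine LipschitzWith.of_dist_le_mul fun x y => ?_
  rw [NNReal.coe_one, one_mul, Real.dist_eq, dist_eq_norm, abs_sub_le_iff]
  exact ⟨support_sub_le A hA x y, norm_sub_rev x y ▸ support_sub_le A hA y x⟩

/-- An additive function on a dense subgroup which is dominated by the support function of a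
compact convex set is the real part of a functional in that set. -/
theorem exists_reEval_eqOn {A : Set (DualBall 𝕜 E)} (hA : A.Nonempty) (hc : IsCompact A)
    (hconv : IsConvex A) {Q : AddSubgroup E} (hQ : Dense (Q : Set E)) {u : E → ℝ}
    (hadd : ∀ x ∈ Q, ∀ y ∈ Q, u (x + y) = u x + u y) (hu : ∀ x ∈ Q, u x ≤ support A x) :
    ∃ φ ∈ A, ∀ x ∈ Q, φ.reEval x = u x := by
  have hsub : ∀ x ∈ Q, ∀ y ∈ Q, u x - u y ≤ ‖x - y‖ := by
    intro x hx y hy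
    have h := hadd (x - y) (Q.sub_mem hx hy) y hy
    rw [sub_add_cancel] at h
    have h2 := (hu _ (Q.sub_mem hx hy)).trans ((le_abs_self _).trans (abs_support_le hA _))
    linarith
  have hlip : LipschitzOnWith 1 u (Q : Set E) := by
    refine LipschitzOnWith.of_dist_le_mul fun x hx y hy => ?_
    rw [NNReal.coe_one, one_mul, Real.dist_eq, dist_eq_norm, abs_sub_le_iff]
    exact ⟨hsub x hx y hy, norm_sub_rev x y ▸ hsub y hy x hx⟩
  obtain ⟨g, hg, hgu⟩ := hlip.extend_real
  have hgadd : ∀ x y, g (x + y) = g x + g y := by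
    have h : (fun p : E × E => g (p.1 + p.2)) = fun p : E × E => g p.1 + g p.2 := by
      refine Continuous.ext_on (hQ.prod hQ) ?_ ?_ ?_
      · exact hg.continuous.comp continuous_add
      · exact (hg.continuous.comp continuous_fst).add (hg.continuous.comp continuous_snd)
      · rintro ⟨x, y⟩ ⟨hx, hy⟩
        change g (x + y) = g x + g y
        rw [← hgu hx, ← hgu hy, ← hgu (Q.add_mem hx hy), hadd x hx y hy]
    exact fun x y => congrFun h (x, y)
  let _ : NormedSpace ℝ E := NormedSpace.restrictScalars ℝ 𝕜 E
  have : IsScalarTower ℝ 𝕜 E := RestrictScalars.isScalarTower ℝ 𝕜 E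
  obtain ⟨φ, hφ, h⟩ := exists_reEval_eq_of_le_support hA hc hconv
    (g := (AddMonoidHom.mk' g hgadd).toRealLinearMap hg.continuous) fun x => by
      refine hQ.induction (P := fun x => g x ≤ support A x) (fun y hy => ?_)
        (isClosed_le hg.continuous (lipschitzWith_support hA).continuous) x
      exact (hgu hy).symm ▸ hu y hy
  exact ⟨φ, hφ, fun x hx => (h x).trans (hgu hx).symm⟩

end

end DualBall

/-! ### Measurable fields of functionals as functionals on `L¹(μ; E)` -/

namespace DualBall

open Filter Topology

section

variable {𝕜 E : Type*} [RCLike 𝕜] [NormedAddCommGroup E] [NormedSpace 𝕜 E]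

/-- Evaluation is jointly continuous, as the functionals in the ball are equicontinuous. -/
theorem continuous_apply_uncurry :
    Continuous fun p : DualBall 𝕜 E × E => p.1.val p.2 := by
  refine continuous_iff_continuousAt.2 fun p => ?_
  rw [ContinuousAt, tendsto_iff_norm_sub_tendsto_zero]
  have h1 : Tendsto (fun q : DualBall 𝕜 E × E => ‖q.2 - p.2‖ + ‖q.1.val p.2 - p.1.val p.2‖)
      (𝓝 p) (𝓝 0) := by
    have h : Continuous fun q : DualBall 𝕜 E × E => ‖q.2 - p.2‖ + ‖q.1.val p.2 - p.1.val p.2‖ :=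
      (continuous_snd.sub continuous_const).norm.add
        (((continuous_eval p.2).comp continuous_fst).sub continuous_const).norm
    simpa using h.tendsto p
  refine squeeze_zero (fun _ => norm_nonneg _) (fun q => ?_) h1
  have h2 : q.1.val q.2 - p.1.val p.2 = q.1.val (q.2 - p.2) + (q.1.val p.2 - p.1.val p.2) := by
    simp
  rw [h2]
  exact (norm_add_le _ _).trans (add_le_add_left (q.1.norm_apply_le _) _)

variable {Z : Type*} [MeasurableSpace Z] {μ : Measure Z}

/-- Functionals on `L¹(μ; E)` are determined by their values on the functions `1_B x`. -/
theorem ext_of_indicator [IsFiniteMeasure μ] {D : Set E} (hD : Dense D)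
    {Φ Ψ : DualBall 𝕜 (Lp E 1 μ)}
    (h : ∀ x ∈ D, ∀ (B : Set Z) (hB : MeasurableSet B),
      Φ.reEval (indicatorConstLp 1 hB (measure_ne_top μ B) x) =
        Ψ.reEval (indicatorConstLp 1 hB (measure_ne_top μ B) x)) : Φ = Ψ := by
  refine ext_of_reEval fun f => ?_
  refine Lp.induction ENNReal.one_ne_top (motive := fun f => Φ.reEval f = Ψ.reEval f) ?_ ?_ ?_ f
  · intro c B hB _
    have hcont : Continuous fun x : E => indicatorConstLp 1 hB (measure_ne_top μ B) x := by
      refine LipschitzWith.continuous (K := (μ.real B).toNNReal)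
        (LipschitzWith.of_dist_le_mul fun x y => ?_)
      rw [dist_eq_norm, indicatorConstLp_sub, norm_indicatorConstLp one_ne_zero ENNReal.one_ne_top,
        dist_eq_norm, Real.coe_toNNReal _ measureReal_nonneg, mul_comm]
      simp
    exact congrFun ((Φ.continuous_reEval.comp hcont).ext_on hD (Ψ.continuous_reEval.comp hcont)
      fun x hx => h x hx B hB) c
  · intro f g hf hg _ h1 h2
    rw [reEval_add, reEval_add, h1, h2]
  · exact isClosed_eq Φ.continuous_reEval Ψ.continuous_reEval

/-- The measure `B ↦ Re Φ(1_B x)` has a density. It is obtained from Riesz representation on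
`L²(μ)`, on which `g ↦ Re Φ(g x)` is bounded because `μ` is finite. -/
theorem exists_density [IsFiniteMeasure μ] (Φ : DualBall 𝕜 (Lp E 1 μ)) (x : E) :
    ∃ u : Z → ℝ, Measurable u ∧ Integrable u μ ∧ ∀ (B : Set Z) (hB : MeasurableSet B),
      ∫ z in B, u z ∂μ = Φ.reEval (indicatorConstLp 1 hB (measure_ne_top μ B) x) := by
  let _ : NormedSpace ℝ E := NormedSpace.restrictScalars ℝ 𝕜 E
  have hint : ∀ g : Lp ℝ 2 μ, Integrable (fun z => g z) μ := fun g =>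
    memLp_one_iff_integrable.1 ((Lp.memLp g).mono_exponent one_le_two)
  have hint' : ∀ g : Lp ℝ 2 μ, Integrable (fun z => g z • x) μ := fun g => (hint g).smul_const x
  let G : Lp ℝ 2 μ →ₗ[ℝ] ℝ :=
    { toFun := fun g => Φ.reEval ((hint' g).toL1 _)
      map_add' := fun f g => by
        rw [← reEval_add, ← Integrable.toL1_add]
        congr 1
        refine (Integrable.toL1_eq_toL1_iff _ _ _ _).2 ?_
        filter_upwards [Lp.coeFn_add f g] with z hz
        change (f + g : Lp ℝ 2 μ) z • x = f z • x + g z • x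
        rw [hz, Pi.add_apply, add_smul]
      map_smul' := fun c g => by
        have h : (hint' (c • g)).toL1 _ = (c : 𝕜) • (hint' g).toL1 _ := by
          rw [← Integrable.toL1_smul']
          refine (Integrable.toL1_eq_toL1_iff _ _ _ _).2 ?_
          filter_upwards [Lp.coeFn_smul c g] with z hz
          rw [hz, Pi.smul_apply, smul_eq_mul, mul_smul]
          rfl
        rw [h, reEval, map_smul, smul_eq_mul, RCLike.re_ofReal_mul]
        rfl }
  have hG : ∀ g, ‖G g‖ ≤ ‖x‖ * μ.real univ ^ (1 / 2 : ℝ) * ‖g‖ := by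
    intro g
    have h1 : ‖G g‖ ≤ ‖(hint' g).toL1 _‖ := Φ.abs_reEval_le _
    have h2 : ‖(hint' g).toL1 _‖ = (∫ z, ‖g z‖ ∂μ) * ‖x‖ := by
      rw [L1.norm_of_fun_eq_integral_norm, ← integral_mul_const]
      simp_rw [norm_smul]
    have h3 : ∫ z, ‖g z‖ ∂μ ≤ ‖g‖ * μ.real univ ^ (1 / 2 : ℝ) := by
      have h := eLpNorm_le_eLpNorm_mul_rpow_measure_univ (μ := μ) one_le_two
        (Lp.aestronglyMeasurable g)
      rw [integral_norm_eq_lintegral_enorm (Lp.aestronglyMeasurable g),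
        ← eLpNorm_one_eq_lintegral_enorm, Lp.norm_def, measureReal_def, ENNReal.toReal_rpow,
        ← ENNReal.toReal_mul]
      refine ENNReal.toReal_mono (ENNReal.mul_ne_top (Lp.eLpNorm_ne_top g)
        (ENNReal.rpow_ne_top_of_nonneg (by norm_num) (measure_ne_top _ _))) (h.trans_eq ?_)
      norm_num
    calc ‖G g‖ ≤ (∫ z, ‖g z‖ ∂μ) * ‖x‖ := h1.trans_eq h2
      _ ≤ (‖g‖ * μ.real univ ^ (1 / 2 : ℝ)) * ‖x‖ := by gcongr
      _ = _ := by ring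
  let u := (InnerProductSpace.toDual ℝ (Lp ℝ 2 μ)).symm (G.mkContinuous _ hG)
  refine ⟨u, (Lp.stronglyMeasurable u).measurable, hint u, fun B hB => ?_⟩
  rw [← L2.inner_indicatorConstLp_one hB (measure_ne_top μ B), real_inner_comm,
    InnerProductSpace.toDual_symm_apply]
  change Φ.reEval _ = _
  congr 1
  refine Lp.ext ((Integrable.coeFn_toL1 _).trans ?_)
  filter_upwards [indicatorConstLp_coeFn (p := 1) (hs := hB) (hμs := measure_ne_top μ B) (c := x),
    indicatorConstLp_coeFn (p := 2) (hs := hB) (hμs := measure_ne_top μ B) (c := (1 : ℝ))]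
    with z h1 h2
  rw [h1, h2]
  by_cases h : z ∈ B <;> simp [h]

variable [TopologicalSpace.SeparableSpace E]

theorem stronglyMeasurable_apply {φ : Z → DualBall 𝕜 E} (hφ : Measurable φ) {f : Z → E}
    (hf : StronglyMeasurable f) : StronglyMeasurable fun z => (φ z).val (f z) :=
  continuous_apply_uncurry.comp_stronglyMeasurable (hφ.stronglyMeasurable.prodMk hf)

theorem integrable_apply {φ : Z → DualBall 𝕜 E} (hφ : Measurable φ) {f : Z → E}
    (hf : Integrable f μ) : Integrable (fun z => (φ z).val (f z)) μ := by
  refine hf.norm.mono' ?_ (ae_of_all _ fun z => (φ z).norm_apply_le (f z))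
  obtain ⟨g, hg, hfg⟩ := hf.aestronglyMeasurable
  exact ⟨_, stronglyMeasurable_apply hφ hg, hfg.mono fun z hz => congrArg (φ z).val hz⟩

theorem integrable_reEval {φ : Z → DualBall 𝕜 E} (hφ : Measurable φ) {f : Z → E}
    (hf : Integrable f μ) : Integrable (fun z => (φ z).reEval (f z)) μ :=
  (integrable_apply hφ hf).re

/-- The functional `f ↦ ∫ φ_z(f(z)) dμ(z)` on `L¹(μ; E)` as a linear map. -/
noncomputable def integralLinearMap (μ : Measure Z) (φ : Z → DualBall 𝕜 E) (hφ : Measurable φ) :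
    Lp E 1 μ →ₗ[𝕜] 𝕜 where
  toFun f := ∫ z, (φ z).val (f z) ∂μ
  map_add' f g := by
    rw [← integral_add (integrable_apply hφ (L1.integrable_coeFn f))
      (integrable_apply hφ (L1.integrable_coeFn g))]
    refine integral_congr_ae ?_
    filter_upwards [Lp.coeFn_add f g] with z hz
    rw [hz, Pi.add_apply, map_add]
  map_smul' c f := by
    rw [RingHom.id_apply, ← integral_smul]
    refine integral_congr_ae ?_
    filter_upwards [Lp.coeFn_smul c f] with z hz
    rw [hz, Pi.smul_apply, map_smul]

theorem norm_integralLinearMap_le {φ : Z → DualBall 𝕜 E} (hφ : Measurable φ) (f : Lp E 1 μ) :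
    ‖integralLinearMap μ φ hφ f‖ ≤ 1 * ‖f‖ := by
  rw [one_mul, L1.norm_eq_integral_norm]
  exact norm_integral_le_of_norm_le (L1.integrable_coeFn f).norm
    (ae_of_all _ fun z => (φ z).norm_apply_le _)

/-- The functional `f ↦ ∫ φ_z(f(z)) dμ(z)` on `L¹(μ; E)` given by a measurable field `φ`. -/
noncomputable def integralFunctional (μ : Measure Z) (φ : Z → DualBall 𝕜 E) (hφ : Measurable φ) :
    DualBall 𝕜 (Lp E 1 μ) :=
  ⟨StrongDual.toWeakDual
    ((integralLinearMap μ φ hφ).mkContinuous 1 (norm_integralLinearMap_le hφ)),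
    LinearMap.mkContinuous_norm_le _ zero_le_one (norm_integralLinearMap_le hφ)⟩

theorem integralFunctional_apply {φ : Z → DualBall 𝕜 E} (hφ : Measurable φ) (f : Lp E 1 μ) :
    (integralFunctional μ φ hφ).val f = ∫ z, (φ z).val (f z) ∂μ := rfl

theorem reEval_integralFunctional {φ : Z → DualBall 𝕜 E} (hφ : Measurable φ) (f : Lp E 1 μ) :
    (integralFunctional μ φ hφ).reEval f = ∫ z, (φ z).reEval (f z) ∂μ :=
  (integral_re (integrable_apply hφ (L1.integrable_coeFn f))).symm

variable [IsFiniteMeasure μ]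

theorem reEval_integralFunctional_indicator {φ : Z → DualBall 𝕜 E} (hφ : Measurable φ)
    {B : Set Z} (hB : MeasurableSet B) (x : E) :
    (integralFunctional μ φ hφ).reEval (indicatorConstLp 1 hB (measure_ne_top μ B) x) =
      ∫ z in B, (φ z).reEval x ∂μ := by
  rw [reEval_integralFunctional, ← integral_indicator hB]
  refine integral_congr_ae ?_
  filter_upwards [indicatorConstLp_coeFn (p := 1) (hs := hB) (hμs := measure_ne_top μ B) (c := x)]
    with z hz
  rw [hz]
  by_cases h : z ∈ B <;> simp [h, reEval]

/-- A measurable field is determined almost everywhere by its functional on `L¹(μ; E)`. -/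
theorem ae_eq_of_integralFunctional_eq {φ ψ : Z → DualBall 𝕜 E} (hφ : Measurable φ)
    (hψ : Measurable ψ) (h : integralFunctional μ φ hφ = integralFunctional μ ψ hψ) :
    φ =ᵐ[μ] ψ := by
  have h1 : ∀ x : denseSubgroup E, ∀ᵐ z ∂μ, (φ z).reEval x.1 = (ψ z).reEval x.1 := by
    intro x
    refine Integrable.ae_eq_of_forall_setIntegral_eq _ _
      (integrable_reEval hφ (integrable_const x.1)) (integrable_reEval hψ (integrable_const x.1))
      fun B hB _ => ?_
    rw [← reEval_integralFunctional_indicator hφ hB, h, reEval_integralFunctional_indicator hψ hB]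
  filter_upwards [ae_all_iff.2 h1] with z hz
  exact ext_of_dense (dense_denseSubgroup E) fun x hx => hz ⟨x, hx⟩

/-- A Borel field of non-empty compact convex subsets of the dual ball. -/
structure IsBorelField (A : Z → Set (DualBall 𝕜 E)) : Prop where
  nonempty : ∀ z, (A z).Nonempty
  compact : ∀ z, IsCompact (A z)
  convex : ∀ z, IsConvex (A z)
  borel : MeasurableSet {p : Z × DualBall 𝕜 E | p.2 ∈ A p.1}

section Field

variable {A : Z → Set (DualBall 𝕜 E)} [StandardBorelSpace Z]

/-- The support function of a Borel field is universally measurable: its superlevel sets are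
projections of Borel sets. -/
theorem IsBorelField.aemeasurable_support (hA : IsBorelField A) (x : E) :
    AEMeasurable (fun z => support (A z) x) μ := by
  have h : ∀ c : ℝ, NullMeasurableSet ((fun z => support (A z) x) ⁻¹' Ioi c) μ := by
    intro c
    let W : Set (Z × DualBall 𝕜 E) := {p | p.2 ∈ A p.1} ∩ {p | c < p.2.reEval x}
    have hW : MeasurableSet W := hA.borel.inter
      (measurableSet_lt measurable_const
        ((continuous_reEval_left x).measurable.comp measurable_snd))
    have : StandardBorelSpace W := hW.standardBorel
    have hr : (fun z => support (A z) x) ⁻¹' Ioi c = range fun w : W => w.1.1 := by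
      ext z
      simp only [mem_preimage, mem_Ioi, mem_range, Subtype.exists]
      constructor
      · intro hz
        obtain ⟨_, ⟨φ, hφ, rfl⟩, hc⟩ := exists_lt_of_lt_csSup ((hA.nonempty z).image _) hz
        exact ⟨(z, φ), ⟨hφ, hc⟩, rfl⟩
      · rintro ⟨⟨z', φ⟩, ⟨hφ, hc⟩, rfl⟩
        exact hc.trans_le (reEval_le_support hφ x)
    rw [hr]
    exact nullMeasurableSet_range μ (measurable_fst.comp measurable_subtype_coe)
  have h' : NullMeasurable (fun z => support (A z) x) μ :=
    @measurable_of_Ioi ℝ (NullMeasurableSpace Z μ) _ _ _ _ _ _ _ _ h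
  exact h'.aemeasurable

theorem IsBorelField.integrable_support (hA : IsBorelField A) (x : E) :
    Integrable (fun z => support (A z) x) μ :=
  (integrable_const ‖x‖).mono' (hA.aemeasurable_support x).aestronglyMeasurable
    (ae_of_all _ fun z => abs_support_le (hA.nonempty z) x)

/-- Measurable selection for a Borel field of non-empty sets. -/
theorem IsBorelField.exists_section (hA : IsBorelField A) (μ : Measure Z) [IsFiniteMeasure μ] :
    ∃ φ : Z → DualBall 𝕜 E, Measurable φ ∧ ∀ᵐ z ∂μ, φ z ∈ A z := by
  rcases isEmpty_or_nonempty Z with hZ | ⟨⟨z₀⟩⟩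
  · exact ⟨fun _ => default, measurable_const, ae_of_all _ fun z => hZ.elim z⟩
  have : StandardBorelSpace {p : Z × DualBall 𝕜 E | p.2 ∈ A p.1} := hA.borel.standardBorel
  obtain ⟨φ₀, hφ₀⟩ := hA.nonempty z₀
  have : Nonempty {p : Z × DualBall 𝕜 E | p.2 ∈ A p.1} := ⟨⟨(z₀, φ₀), hφ₀⟩⟩
  obtain ⟨T, h, hT, -, hT0, hh, hhT⟩ := exists_measurable_rightInverse_ae μ
    (f := fun w : {p : Z × DualBall 𝕜 E | p.2 ∈ A p.1} => w.1.1)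
    (measurable_fst.comp measurable_subtype_coe)
  refine ⟨fun z => (h z).1.2, measurable_snd.comp (measurable_subtype_coe.comp hh), ?_⟩
  refine measure_mono_null (fun z hz => ?_) hT0
  refine ⟨?_, fun hzT => hz ?_⟩
  · obtain ⟨φ, hφ⟩ := hA.nonempty z
    exact ⟨⟨(z, φ), hφ⟩, rfl⟩
  · have := (h z).2
    have h2 := hhT z hzT
    rwa [mem_ofPred_eq, h2] at this

/-- The functionals on `L¹(μ; E)` given by the measurable sections of a field. -/
def sectionFunctionals (μ : Measure Z) [IsFiniteMeasure μ] (A : Z → Set (DualBall 𝕜 E)) :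
    Set (DualBall 𝕜 (Lp E 1 μ)) :=
  {Φ | ∃ (φ : Z → DualBall 𝕜 E) (hφ : Measurable φ), (∀ᵐ z ∂μ, φ z ∈ A z) ∧
    Φ = integralFunctional μ φ hφ}

/-- The functionals given by sections are cut out by weak-* closed half spaces. Conversely to the
obvious inequality, a functional `Φ` in all of these half spaces has densities `u_x` with
`Re Φ(1_B x) = ∫_B u_x`; for almost every `z` the function `x ↦ u_x(z)` is additive and dominated by
the support function of `A z`, so it is the real part of a point of `A z`. -/
theorem IsBorelField.mem_sectionFunctionals_iff (hA : IsBorelField A)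
    {Φ : DualBall 𝕜 (Lp E 1 μ)} : Φ ∈ sectionFunctionals μ A ↔
      ∀ x ∈ denseSubgroup E, ∀ (B : Set Z) (hB : MeasurableSet B),
        Φ.reEval (indicatorConstLp 1 hB (measure_ne_top μ B) x) ≤
          ∫ z in B, support (A z) x ∂μ := by
  constructor
  · rintro ⟨φ, hφ, hφA, rfl⟩ x - B hB
    rw [reEval_integralFunctional_indicator hφ hB]
    refine integral_mono_ae (integrable_reEval hφ (integrable_const x)).integrableOn
      (hA.integrable_support x).integrableOn (ae_restrict_of_ae ?_)
    exact hφA.mono fun z hz => reEval_le_support hz x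
  · intro h
    choose u hum hui hu using exists_density Φ
    have hadd : ∀ x y : denseSubgroup E, ∀ᵐ z ∂μ, u (x + y) z = u x z + u y z := by
      intro x y
      refine Integrable.ae_eq_of_forall_setIntegral_eq _ (fun z => u x z + u y z) (hui _)
        ((hui _).add (hui _)) fun B hB _ => ?_
      rw [integral_add (hui _).integrableOn (hui _).integrableOn, hu _ B hB, hu _ B hB, hu _ B hB,
        ← reEval_add, indicatorConstLp_add]
    have hle : ∀ x : denseSubgroup E, ∀ᵐ z ∂μ, u x z ≤ support (A z) x := by
      intro x
      refine ae_le_of_forall_setIntegral_le (hui _) (hA.integrable_support _) fun B hB _ => ?_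
      rw [hu _ B hB]
      exact h x x.2 B hB
    have hgood : ∀ᵐ z ∂μ, (∀ x y : denseSubgroup E, u (x + y) z = u x z + u y z) ∧
        ∀ x : denseSubgroup E, u x z ≤ support (A z) x :=
      (ae_all_iff.2 fun x => ae_all_iff.2 (hadd x)).and (ae_all_iff.2 hle)
    obtain ⟨S, hS, hSm, hS0⟩ := hgood.exists_measurable_mem
    have hφ : ∀ z ∈ S, ∃ φ ∈ A z, ∀ x ∈ denseSubgroup E, φ.reEval x = u x z := fun z hz =>
      exists_reEval_eqOn (hA.nonempty z) (hA.compact z) (hA.convex z) (dense_denseSubgroup E)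
        (u := fun x => u x z)
        (fun x hx y hy => (hS0 z hz).1 ⟨x, hx⟩ ⟨y, hy⟩) fun x hx => (hS0 z hz).2 ⟨x, hx⟩
    choose! φ hφA hφu using hφ
    classical
    have hmeas : Measurable (S.piecewise φ fun _ => default) := by
      refine measurable_of_reEval fun x hx => ?_
      have hp : (fun z => (S.piecewise φ (fun _ => default) z).reEval x) =
          S.piecewise (u x) fun _ => (default : DualBall 𝕜 E).reEval x := by
        funext z
        by_cases hz : z ∈ S
        · rw [piecewise_eq_of_mem _ _ _ hz, piecewise_eq_of_mem _ _ _ hz, hφu z hz x hx]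
        · rw [piecewise_eq_of_notMem _ _ _ hz, piecewise_eq_of_notMem _ _ _ hz]
      rw [hp]
      exact (hum x).piecewise hSm measurable_const
    refine ⟨_, hmeas, ?_, ext_of_indicator (dense_denseSubgroup E) fun x hx B hB => ?_⟩
    · filter_upwards [hS] with z hz
      rw [piecewise_eq_of_mem _ _ _ hz]
      exact hφA z hz
    · rw [reEval_integralFunctional_indicator hmeas hB, ← hu x B hB]
      refine integral_congr_ae (ae_restrict_of_ae ?_)
      filter_upwards [hS] with z hz
      rw [piecewise_eq_of_mem _ _ _ hz, hφu z hz x hx]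

theorem IsBorelField.isClosed_sectionFunctionals (hA : IsBorelField A) :
    IsClosed (sectionFunctionals μ A) := by
  have h : sectionFunctionals μ A = ⋂ x ∈ denseSubgroup E, ⋂ (B : Set Z) (hB : MeasurableSet B),
      {Φ | Φ.reEval (indicatorConstLp 1 hB (measure_ne_top μ B) x) ≤
        ∫ z in B, support (A z) x ∂μ} := by
    ext Φ
    simp only [mem_iInter]
    exact hA.mem_sectionFunctionals_iff
  rw [h]
  exact isClosed_biInter fun x _ => isClosed_iInter fun B => isClosed_iInter fun hB =>
    isClosed_le (continuous_reEval_left _) continuous_const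

theorem IsBorelField.isConvex_sectionFunctionals (hA : IsBorelField A) :
    IsConvex (sectionFunctionals μ A) := by
  intro Φ hΦ Ψ hΨ a b ha hb hab
  refine ⟨⟨(a : 𝕜) • Φ.val + (b : 𝕜) • Ψ.val, ?_⟩, hA.mem_sectionFunctionals_iff.2 ?_, rfl⟩
  · rw [map_add, map_smul, map_smul]
    refine (norm_add_le _ _).trans ?_
    rw [norm_smul, norm_smul, RCLike.norm_of_nonneg ha, RCLike.norm_of_nonneg hb]
    exact (add_le_add (mul_le_of_le_one_right ha Φ.property)
      (mul_le_of_le_one_right hb Ψ.property)).trans_eq hab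
  · rw [hA.mem_sectionFunctionals_iff] at hΦ hΨ
    intro x hx B hB
    have h : ∀ f, RCLike.re (((a : 𝕜) • Φ.val + (b : 𝕜) • Ψ.val) f) =
        a * Φ.reEval f + b * Ψ.reEval f := by
      intro f
      change RCLike.re ((a : 𝕜) * Φ.val f + (b : 𝕜) * Ψ.val f) = _
      rw [map_add, RCLike.re_ofReal_mul, RCLike.re_ofReal_mul]
      rfl
    refine (h _).trans_le ?_
    calc _ ≤ a * (∫ z in B, support (A z) x ∂μ) + b * ∫ z in B, support (A z) x ∂μ :=
          add_le_add (mul_le_mul_of_nonneg_left (hΦ x hx B hB) ha)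
            (mul_le_mul_of_nonneg_left (hΨ x hx B hB) hb)
      _ = _ := by rw [← add_mul, hab, one_mul]

theorem IsBorelField.nonempty_sectionFunctionals (hA : IsBorelField A) :
    (sectionFunctionals μ A).Nonempty := by
  obtain ⟨φ, hφ, hφA⟩ := hA.exists_section μ
  exact ⟨_, φ, hφ, hφA, rfl⟩

end Field

end

end DualBall

/-! ### Automatic continuity of measurable isometric representations -/

section Continuity

open Filter Topology

/-- A measurable anti-homomorphism from a locally compact group to the isometries of a separable
Banach space is strongly continuous: by Steinhaus' theorem, the differences of a set of
positive Haar measure on which `s ↦ U_s f` is almost constant contain a neighbourhood of `1`. -/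
theorem continuous_of_measurable_isometric {𝕜 G V : Type*} [RCLike 𝕜] [Group G]
    [TopologicalSpace G] [IsTopologicalGroup G] [LocallyCompactSpace G]
    [SecondCountableTopology G] [T2Space G] [MeasurableSpace G] [BorelSpace G]
    [NormedAddCommGroup V] [NormedSpace 𝕜 V] [TopologicalSpace.SeparableSpace V]
    {U : G → (V ≃ₗᵢ[𝕜] V)} (hU : ∀ s t, U (t * s) = U s * U t) {f : V}
    (hm : ∀ g, Measurable fun s => ‖U s f - g‖) : Continuous fun s => U s f := by
  have hU1 : U 1 = 1 := by
    have h := hU 1 1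
    rw [mul_one] at h
    exact mul_eq_left.1 h.symm
  have hdist : ∀ a b, ‖U (a * b⁻¹) f - f‖ = ‖U a f - U b f‖ := by
    intro a b
    have h1 : f = U b⁻¹ (U b f) := by
      have h := DFunLike.congr_fun (hU b⁻¹ b) f
      rw [mul_inv_cancel, hU1] at h
      exact h
    have h2 : U (a * b⁻¹) f = U b⁻¹ (U a f) := by
      rw [hU]
      rfl
    rw [h2]
    nth_rw 2 [h1]
    rw [← map_sub, LinearIsometryEquiv.norm_map]
  have hnear : ∀ ε > 0, ∀ᶠ s in 𝓝 (1 : G), ‖U s f - f‖ < ε := by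
    intro ε hε
    let g := TopologicalSpace.denseSeq V
    let B : ℕ → Set G := fun n => {s | ‖U s f - g n‖ < ε / 2}
    have hB : ⋃ n, B n = univ := by
      refine eq_univ_of_forall fun s => ?_
      obtain ⟨n, hn⟩ := (TopologicalSpace.denseRange_denseSeq V).exists_dist_lt (U s f)
        (half_pos hε)
      exact mem_iUnion.2 ⟨n, by simpa [B, g, dist_eq_norm] using hn⟩
    obtain ⟨n, hn⟩ : ∃ n, 0 < Measure.haar (B n) := by
      by_contra! hcon
      have h0 : Measure.haar (univ : Set G) = 0 := by
        rw [← hB]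
        exact measure_iUnion_null fun n => nonpos_iff_eq_zero.1 (hcon n)
      exact (isOpen_univ.measure_pos Measure.haar univ_nonempty).ne' h0
    have hBm : MeasurableSet (B n) := measurableSet_lt (hm (g n)) measurable_const
    filter_upwards [Measure.div_mem_nhds_one_of_haar_pos Measure.haar (B n) hBm hn]
    rintro _ ⟨a, ha, b, hb, rfl⟩
    change ‖U (a / b) f - f‖ < ε
    rw [div_eq_mul_inv, hdist, ← sub_sub_sub_cancel_right _ _ (g n)]
    exact (norm_sub_le _ _).trans_lt ((add_lt_add ha hb).trans_eq (add_halves ε))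
  refine continuous_iff_continuousAt.2 fun s₀ => Metric.tendsto_nhds.2 fun ε hε => ?_
  have h : Tendsto (fun s => s * s₀⁻¹) (𝓝 s₀) (𝓝 1) := by
    simpa using (continuous_mul_const s₀⁻¹).tendsto s₀
  filter_upwards [h.eventually (hnear ε hε)] with s hs
  rwa [dist_eq_norm, ← hdist]

end Continuity

/-! ### The twisted regular representation on `L¹(μ; E)` -/

section Density

open ProbabilityTheory

variable {G Z : Type*} [Group G] [MeasurableSpace G] [MeasurableInv G] [MeasurableSpace Z]
  [MulAction G Z] [MeasurableSMul₂ G Z]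

/-- The kernel `s ↦ (s⁻¹)_* μ`, of which the Radon–Nikodym derivatives can be chosen jointly
measurable. -/
noncomputable def translateKernel (G : Type*) [Group G] [MeasurableSpace G] [MeasurableInv G]
    [MulAction G Z] [MeasurableSMul₂ G Z] (μ : Measure Z) [IsFiniteMeasure μ] : Kernel G Z where
  toFun s := μ.map (s⁻¹ • ·)
  measurable' := by
    refine Measure.measurable_of_measurable_coe _ fun B hB => ?_
    have h : Measurable fun p : G × Z => p.1⁻¹ • p.2 := measurable_fst.inv.smul measurable_snd
    have h2 : (fun s : G => μ.map (s⁻¹ • ·) B) =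
        fun s => μ (Prod.mk s ⁻¹' ((fun p : G × Z => p.1⁻¹ • p.2) ⁻¹' B)) := by
      funext s
      rw [Measure.map_apply (measurable_const_smul _) hB]
      rfl
    rw [h2]
    exact measurable_measure_prodMk_left (h hB)

variable (μ : Measure Z) [IsFiniteMeasure μ]

instance : IsFiniteKernel (translateKernel G μ) :=
  ⟨μ univ, measure_lt_top _ _, fun s => by
    change μ.map (s⁻¹ • ·) univ ≤ _
    rw [Measure.map_apply (measurable_const_smul _) .univ, preimage_univ]⟩

variable [StandardBorelSpace Z]

/-- The density `ρ_s = d((s⁻¹)_* μ)/dμ`, in a jointly measurable version. -/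
noncomputable def translateDensity (s : G) (z : Z) : ENNReal :=
  (translateKernel G μ).rnDeriv (Kernel.const G μ) s z

theorem measurable_translateDensity :
    Measurable fun p : G × Z => translateDensity μ p.1 p.2 :=
  Kernel.measurable_rnDeriv _ _

theorem translateDensity_ae_eq (s : G) :
    translateDensity μ s =ᵐ[μ] (μ.map (s⁻¹ • ·)).rnDeriv μ :=
  Kernel.rnDeriv_eq_rnDeriv_measure (κ := translateKernel G μ) (η := Kernel.const G μ) (a := s)

variable {μ} (hμ : ∀ s : G, μ.map (s • ·) ≪ μ)
include hμ

/-- The change of variables formula `∫ ρ_s(z) F(sz) dμ(z) = ∫ F dμ`. -/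
theorem lintegral_translateDensity (s : G) {F : Z → ENNReal} (hF : Measurable F) :
    ∫⁻ z, translateDensity μ s z * F (s • z) ∂μ = ∫⁻ z, F z ∂μ := by
  have hm : Measurable fun z => F (s • z) := hF.comp (measurable_const_smul s)
  calc _ = ∫⁻ z, (μ.map (s⁻¹ • ·)).rnDeriv μ z * F (s • z) ∂μ :=
        lintegral_congr_ae ((translateDensity_ae_eq μ s).mono fun z hz => by simp only [hz])
    _ = ∫⁻ z, F (s • z) ∂μ.map (s⁻¹ • ·) := lintegral_rnDeriv_mul (hμ s⁻¹) hm.aemeasurable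
    _ = _ := by simp [lintegral_map hm (measurable_const_smul s⁻¹)]

/-- The densities form a multiplicative cocycle, up to null sets. -/
theorem translateDensity_mul (s t : G) :
    ∀ᵐ z ∂μ, translateDensity μ (t * s) z =
      translateDensity μ s z * translateDensity μ t (s • z) := by
  have hm : ∀ s : G, Measurable (translateDensity μ s) := fun s =>
    (measurable_translateDensity μ).comp measurable_prodMk_left
  have hms : Measurable fun z => translateDensity μ t (s • z) :=
    (hm t).comp (measurable_const_smul s)
  refine ae_eq_of_forall_setLIntegral_eq_of_sigmaFinite (hm _) ((hm s).mul hms) fun B hB _ => ?_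
  -- both integrals are the measure of `ts • B`
  have hind : Measurable ((((t * s)⁻¹ • ·) ⁻¹' B).indicator (1 : Z → ENNReal)) :=
    measurable_one.indicator (measurable_const_smul _ hB)
  have h1 := lintegral_translateDensity hμ (t * s) hind
  have h2 := lintegral_translateDensity hμ t hind
  have h3 := lintegral_translateDensity hμ s ((hm t).mul (hind.comp (measurable_const_smul t)))
  rw [← lintegral_indicator hB, ← lintegral_indicator hB]
  trans ∫⁻ z, (((t * s)⁻¹ • ·) ⁻¹' B).indicator (1 : Z → ENNReal) z ∂μ
  · rw [← h1]
    refine lintegral_congr fun z => ?_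
    by_cases hz : z ∈ B <;> simp [hz, indicator, -mul_inv_rev]
  · rw [← h2]
    refine h3.symm.trans (lintegral_congr fun z => ?_)
    by_cases hz : z ∈ B <;> simp [hz, indicator, mul_smul]

theorem integral_translateDensity {V : Type*} [NormedAddCommGroup V] [NormedSpace ℝ V] (s : G)
    (F : Z → V) : ∫ z, (translateDensity μ s z).toReal • F (s • z) ∂μ = ∫ z, F z ∂μ := by
  calc _ = ∫ z, ((μ.map (s⁻¹ • ·)).rnDeriv μ z).toReal • F (s • z) ∂μ :=
        integral_congr_ae ((translateDensity_ae_eq μ s).mono fun z hz => by simp only [hz])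
    _ = ∫ z, F (s • z) ∂μ.map (s⁻¹ • ·) := integral_rnDeriv_smul (hμ s⁻¹)
    _ = _ := by
      refine ((measurableEmbedding_const_smul s⁻¹).integral_map _).trans ?_
      simp

theorem integrable_translateDensity {V : Type*} [NormedAddCommGroup V] [NormedSpace ℝ V] (s : G)
    {F : Z → V} (hF : Integrable F μ) :
    Integrable (fun z => (translateDensity μ s z).toReal • F (s • z)) μ := by
  have h1 : Integrable (fun z => F (s • z)) (μ.map (s⁻¹ • ·)) := by
    rw [(measurableEmbedding_const_smul s⁻¹).integrable_map_iff]
    refine hF.congr (ae_of_all _ fun z => ?_)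
    simp
  exact ((integrable_rnDeriv_smul_iff (hμ s⁻¹)).2 h1).congr
    ((translateDensity_ae_eq μ s).mono fun z hz => by simp only [hz])

end Density

section RegularRepresentation

variable {𝕜 E G Z : Type*} [RCLike 𝕜] [NormedAddCommGroup E] [NormedSpace 𝕜 E]
  [Group G] [MeasurableSpace G] [MeasurableSpace Z] [MulAction G Z]

/-- A strictly multiplicative cocycle of a group action, with values in the isometries of `E`, all
of whose evaluations are strongly measurable. -/
structure IsStrongCocycle (σ : Z × G → (E ≃ₗᵢ[𝕜] E)) : Prop where
  stronglyMeasurable : ∀ x, StronglyMeasurable fun p => σ p x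
  mul : ∀ (s t : G) (z : Z), σ (z, t * s) = σ (z, s) * σ (s • z, t)

namespace IsStrongCocycle

variable {σ : Z × G → (E ≃ₗᵢ[𝕜] E)} (hσ : IsStrongCocycle σ)
include hσ

theorem one (z : Z) : σ (z, 1) = 1 := by
  have h := hσ.mul 1 1 z
  rw [mul_one, one_smul] at h
  exact mul_eq_left.1 h.symm

theorem inv (s : G) (z : Z) : (σ (z, s))⁻¹ = σ (s • z, s⁻¹) := by
  have h := hσ.mul s s⁻¹ z
  rw [inv_mul_cancel, hσ.one] at h
  exact inv_eq_of_mul_eq_one_right h.symm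

variable [TopologicalSpace.SeparableSpace E]

theorem stronglyMeasurable_apply {Y : Type*} [MeasurableSpace Y] {p : Y → Z × G}
    (hp : Measurable p) {f : Y → E} (hf : StronglyMeasurable f) :
    StronglyMeasurable fun y => σ (p y) (f y) := by
  borelize E
  have := UniformSpace.secondCountable_of_separable E
  have h := stronglyMeasurable_uncurry_of_continuous_of_stronglyMeasurable
    (u := fun (x : E) (p : Z × G) => σ p x) (fun p => (σ p).continuous) hσ.stronglyMeasurable
  exact h.comp_measurable (hf.measurable.prodMk hp)

end IsStrongCocycle

theorem ae_smul [MeasurableSMul₂ G Z] {μ : Measure Z} (hμ : ∀ s : G, μ.map (s • ·) ≪ μ)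
    {p : Z → Prop} (h : ∀ᵐ z ∂μ, p z) (s : G) : ∀ᵐ z ∂μ, p (s • z) :=
  (Measure.QuasiMeasurePreserving.mk (measurable_const_smul s) (hμ s)).ae h

/-- The field `z ↦ σ^*(z, t) φ(tz)`. -/
noncomputable def twistedField (σ : Z × G → (E ≃ₗᵢ[𝕜] E)) (φ : Z → DualBall 𝕜 E) (t : G) (z : Z) :
    DualBall 𝕜 E :=
  DualBall.invAdjoint (σ (z, t)) (φ (t • z))

theorem measurable_twistedField [TopologicalSpace.SeparableSpace E] [MeasurableSMul₂ G Z]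
    {σ : Z × G → (E ≃ₗᵢ[𝕜] E)} (hσ : IsStrongCocycle σ) {φ : Z → DualBall 𝕜 E}
    (hφ : Measurable φ) (t : G) : Measurable (twistedField σ φ t) := by
  refine DualBall.measurable_of_reEval fun x _ => ?_
  have h : (fun z => (twistedField σ φ t z).reEval x) =
      fun z => RCLike.re ((φ (t • z)).val (σ (t • z, t⁻¹) x)) := by
    funext z
    rw [DualBall.reEval, twistedField, DualBall.invAdjoint_apply, hσ.inv]
  rw [h]
  have h1 : Measurable fun z : Z => t • z := measurable_const_smul t
  exact RCLike.measurable_re.comp (DualBall.stronglyMeasurable_apply (hφ.comp h1)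
    ((hσ.stronglyMeasurable x).comp_measurable (h1.prodMk measurable_const))).measurable

variable [MeasurableInv G] [StandardBorelSpace Z] [MeasurableSMul₂ G Z]

/-- The twisted translate `z ↦ ρ_s(z) σ(z, s) f(sz)` of `f`. -/
noncomputable def twistedTranslate (μ : Measure Z) [IsFiniteMeasure μ] (σ : Z × G → (E ≃ₗᵢ[𝕜] E))
    (f : Z → E) (s : G) (z : Z) : E :=
  ((translateDensity μ s z).toReal : 𝕜) • σ (z, s) (f (s • z))

variable {μ : Measure Z} [IsFiniteMeasure μ] {σ : Z × G → (E ≃ₗᵢ[𝕜] E)}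

theorem norm_twistedTranslate (f : Z → E) (s : G) (z : Z) :
    ‖twistedTranslate μ σ f s z‖ = (translateDensity μ s z).toReal • ‖f (s • z)‖ := by
  rw [twistedTranslate, norm_smul, LinearIsometryEquiv.norm_map,
    RCLike.norm_of_nonneg ENNReal.toReal_nonneg, smul_eq_mul]

variable (hμ : ∀ s : G, μ.map (s • ·) ≪ μ)

variable [TopologicalSpace.SeparableSpace E] (hσ : IsStrongCocycle σ)

include hσ in
theorem stronglyMeasurable_twistedTranslate {f : Z → E} (hf : StronglyMeasurable f) :
    StronglyMeasurable fun p : G × Z => twistedTranslate μ σ f p.1 p.2 := by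
  have h1 : Measurable fun p : G × Z => p.1 • p.2 := measurable_smul
  have h2 : Measurable fun p : G × Z => ((translateDensity μ p.1 p.2).toReal : 𝕜) :=
    RCLike.measurable_ofReal.comp (measurable_translateDensity μ).ennreal_toReal
  exact h2.stronglyMeasurable.smul
    (hσ.stronglyMeasurable_apply measurable_swap (hf.comp_measurable h1))

include hμ hσ in
theorem integrable_twistedTranslate (f : Lp E 1 μ) (s : G) :
    Integrable (twistedTranslate μ σ f s) μ := by
  refine (integrable_norm_iff ?_).1 ?_
  · exact ((stronglyMeasurable_twistedTranslate hσ (Lp.stronglyMeasurable f)).comp_measurable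
      measurable_prodMk_left).aestronglyMeasurable
  · simp only [norm_twistedTranslate]
    exact integrable_translateDensity hμ s (L1.integrable_coeFn f).norm

/-- The operator `f ↦ ρ_s σ(·, s) f(s ·)` on `L¹(μ; E)`. -/
noncomputable def regularIsometry (s : G) : Lp E 1 μ →ₗᵢ[𝕜] Lp E 1 μ where
  toFun f := (integrable_twistedTranslate hμ hσ f s).toL1 _
  map_add' f g := by
    rw [← Integrable.toL1_add]
    refine (Integrable.toL1_eq_toL1_iff _ _ _ _).2 ?_
    filter_upwards [ae_smul hμ (Lp.coeFn_add f g) s] with z hz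
    rw [Pi.add_apply]
    simp only [twistedTranslate]
    rw [hz, Pi.add_apply, map_add, smul_add]
  map_smul' c f := by
    rw [RingHom.id_apply, ← Integrable.toL1_smul']
    refine (Integrable.toL1_eq_toL1_iff _ _ _ _).2 ?_
    filter_upwards [ae_smul hμ (Lp.coeFn_smul c f) s] with z hz
    rw [Pi.smul_apply]
    simp only [twistedTranslate]
    rw [hz, Pi.smul_apply, map_smul, smul_comm]
  norm_map' f := by
    change ‖(integrable_twistedTranslate hμ hσ f s).toL1 _‖ = ‖f‖
    rw [L1.norm_of_fun_eq_integral_norm, L1.norm_eq_integral_norm]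
    simp only [norm_twistedTranslate]
    exact integral_translateDensity hμ s fun z => ‖f z‖

theorem coeFn_regularIsometry (s : G) (f : Lp E 1 μ) :
    regularIsometry hμ hσ s f =ᵐ[μ] twistedTranslate μ σ f s :=
  (integrable_twistedTranslate hμ hσ f s).coeFn_toL1

theorem regularIsometry_mul (s t : G) (f : Lp E 1 μ) :
    regularIsometry hμ hσ (t * s) f = regularIsometry hμ hσ s (regularIsometry hμ hσ t f) := by
  refine Lp.ext ?_
  filter_upwards [coeFn_regularIsometry hμ hσ (t * s) f,
    coeFn_regularIsometry hμ hσ s (regularIsometry hμ hσ t f),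
    ae_smul hμ (coeFn_regularIsometry hμ hσ t f) s, translateDensity_mul hμ s t] with z h1 h2 h3 h4
  rw [h1, h2]
  simp only [twistedTranslate] at h3 ⊢
  rw [h3, h4, hσ.mul, mul_smul t s z, map_smul, ENNReal.toReal_mul, RCLike.ofReal_mul, mul_smul]
  rfl

theorem regularIsometry_one (f : Lp E 1 μ) : regularIsometry hμ hσ 1 f = f := by
  refine (regularIsometry hμ hσ 1).injective ?_
  rw [← regularIsometry_mul, one_mul]

/-- The twisted regular representation of `G` on `L¹(μ; E)`. It is an anti-homomorphism, as is the
cocycle `σ` in its group variable. -/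
noncomputable def regularRep (s : G) : Lp E 1 μ ≃ₗᵢ[𝕜] Lp E 1 μ :=
  LinearIsometryEquiv.ofSurjective (regularIsometry hμ hσ s) fun f =>
    ⟨regularIsometry hμ hσ s⁻¹ f, by
      rw [← regularIsometry_mul, inv_mul_cancel, regularIsometry_one]⟩

theorem regularRep_apply (s : G) (f : Lp E 1 μ) :
    regularRep hμ hσ s f = regularIsometry hμ hσ s f := rfl

theorem regularRep_mul (s t : G) :
    regularRep hμ hσ (t * s) = regularRep hμ hσ s * regularRep hμ hσ t :=
  LinearIsometryEquiv.ext fun f => regularIsometry_mul hμ hσ s t f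

theorem regularRep_inv (s : G) : (regularRep hμ hσ s)⁻¹ = regularRep hμ hσ s⁻¹ := by
  refine inv_eq_of_mul_eq_one_right ?_
  rw [← regularRep_mul, inv_mul_cancel]
  exact LinearIsometryEquiv.ext fun f => regularIsometry_one hμ hσ f

/-- Measurability of the orbit maps of the regular representation, in the form in which it gives
their continuity. -/
theorem measurable_norm_regularRep_sub (f g : Lp E 1 μ) :
    Measurable fun s => ‖regularRep hμ hσ s f - g‖ := by
  have h : (fun s => ‖regularRep hμ hσ s f - g‖) =
      fun s => ∫ z, ‖twistedTranslate μ σ f s z - g z‖ ∂μ := by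
    funext s
    rw [L1.norm_eq_integral_norm]
    refine integral_congr_ae ?_
    filter_upwards [Lp.coeFn_sub (regularRep hμ hσ s f) g, coeFn_regularIsometry hμ hσ s f]
      with z h1 h2
    rw [h1, Pi.sub_apply, regularRep_apply, h2]
  rw [h]
  refine (StronglyMeasurable.integral_prod_right (ν := μ)
    (f := fun s z => ‖twistedTranslate μ σ f s z - g z‖) ?_).measurable
  exact ((stronglyMeasurable_twistedTranslate hσ (Lp.stronglyMeasurable f)).sub
    ((Lp.stronglyMeasurable g).comp_measurable measurable_snd)).norm

/-- The regular representation moves the functional of a field to that of the twisted field. -/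
theorem invAdjoint_regularRep_integralFunctional {φ : Z → DualBall 𝕜 E} (hφ : Measurable φ)
    (t : G) : DualBall.invAdjoint (regularRep hμ hσ t) (DualBall.integralFunctional μ φ hφ) =
      DualBall.integralFunctional μ (twistedField σ φ t) (measurable_twistedField hσ hφ t) := by
  refine DualBall.ext_of_apply fun f => ?_
  rw [DualBall.invAdjoint_apply, regularRep_inv, DualBall.integralFunctional_apply,
    DualBall.integralFunctional_apply,
    ← integral_translateDensity hμ t⁻¹ fun z => (twistedField σ φ t z).val (f z)]
  refine integral_congr_ae ?_
  filter_upwards [coeFn_regularIsometry hμ hσ t⁻¹ f] with z hz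
  rw [regularRep_apply, hz, twistedTranslate, map_smul, twistedField, DualBall.invAdjoint_apply,
    hσ.inv, smul_inv_smul, RCLike.real_smul_eq_coe_smul (K := 𝕜)]

variable {A : Z → Set (DualBall 𝕜 E)}

/-- The functionals given by the sections of an invariant field form an invariant set. -/
theorem invAdjoint_regularRep_image_sectionFunctionals
    (hA : ∀ s : G, ∀ᵐ z ∂μ, DualBall.invAdjoint (σ (z, s)) '' A (s • z) = A z) (t : G) :
    DualBall.invAdjoint (regularRep hμ hσ t) '' DualBall.sectionFunctionals μ A =
      DualBall.sectionFunctionals μ A := by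
  have h : ∀ t, ∀ Φ ∈ DualBall.sectionFunctionals μ A,
      DualBall.invAdjoint (regularRep hμ hσ t) Φ ∈ DualBall.sectionFunctionals μ A := by
    rintro t _ ⟨φ, hφ, hφA, rfl⟩
    refine ⟨_, measurable_twistedField hσ hφ t, ?_,
      invAdjoint_regularRep_integralFunctional hμ hσ hφ t⟩
    filter_upwards [hA t, ae_smul hμ hφA t] with z h1 h2
    rw [← h1]
    exact mem_image_of_mem _ h2
  refine Subset.antisymm (image_subset_iff.2 (h t)) fun Φ hΦ => ⟨_, h t⁻¹ Φ hΦ, ?_⟩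
  refine DualBall.ext_of_apply fun f => ?_
  rw [DualBall.invAdjoint_apply, DualBall.invAdjoint_apply, ← regularRep_inv, inv_inv]
  exact congrArg Φ.val ((regularRep hμ hσ t).apply_symm_apply f)

/-- A field whose functional is fixed by `t` is itself invariant under `t`. -/
theorem ae_eq_of_invAdjoint_regularRep_eq {φ : Z → DualBall 𝕜 E} (hφ : Measurable φ) {t : G}
    (h : DualBall.invAdjoint (regularRep hμ hσ t) (DualBall.integralFunctional μ φ hφ) =
      DualBall.integralFunctional μ φ hφ) :
    ∀ᵐ z ∂μ, DualBall.invAdjoint (σ (z, t)) (φ (t • z)) = φ z := by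
  rw [invAdjoint_regularRep_integralFunctional] at h
  exact DualBall.ae_eq_of_integralFunctional_eq _ hφ h

end RegularRepresentation

/-! ### The enveloping space -/

theorem MeasurableEquiv.standardBorelSpace {Z S : Type*} [MeasurableSpace Z] [MeasurableSpace S]
    [StandardBorelSpace S] (e : Z ≃ᵐ S) : StandardBorelSpace Z := by
  let := upgradeStandardBorel S
  refine ⟨⟨TopologicalSpace.induced e inferInstance, @BorelSpace.mk _ (_) _ ?_,
    e.toEquiv.polishSpace_induced⟩⟩
  rw [borel_comap, ← BorelSpace.measurable_eq]
  exact e.measurableEmbedding.comap_eq.symm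

/-- Evaluations are measurable for the Borel structure of the strong operator topology. -/
theorem stronglyMeasurable_eval_of_isoBorel {𝕜 E W : Type*} [RCLike 𝕜] [NormedAddCommGroup E]
    [NormedSpace 𝕜 E] [TopologicalSpace.SeparableSpace E] [MeasurableSpace W]
    {τ : W → (E ≃ₗᵢ[𝕜] E)} (hτ : Measurable[inferInstance, isoBorel 𝕜 E] τ) (x : E) :
    StronglyMeasurable fun w => τ w x := by
  borelize E
  have := UniformSpace.secondCountable_of_separable E
  let t : TopologicalSpace (E ≃ₗᵢ[𝕜] E) :=
    TopologicalSpace.induced (fun (T : E ≃ₗᵢ[𝕜] E) (x : E) => T x) inferInstance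
  let _ : MeasurableSpace (E ≃ₗᵢ[𝕜] E) := isoBorel 𝕜 E
  have : BorelSpace (E ≃ₗᵢ[𝕜] E) := ⟨rfl⟩
  have hc : Continuous fun T : E ≃ₗᵢ[𝕜] E => T x :=
    (continuous_apply x).comp continuous_induced_dom
  exact (hc.measurable.comp hτ).stronglyMeasurable

namespace PartialAction

open Topology

variable {G X : Type*} [Group G] [TopologicalSpace G] [TopologicalSpace X]

theorem toEnvelope_eq_iff (α : PartialAction G X) {x y : X} {r s : G} :
    α.toEnvelope x r = α.toEnvelope y s ↔
      x ∈ α.toMaps.dom (r⁻¹ * s) ∧ α.toMaps.act (s⁻¹ * r) x = y :=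
  Quotient.eq (r := α.envSetoid)

theorem smul_ι (α : PartialAction G X) (g : G) (x : X) : g • α.ι x = α.toEnvelope x g := by
  rw [ι, smul_toEnvelope, mul_one]

theorem smul_ι_eq_ι_iff (α : PartialAction G X) {g : G} {x y : X} :
    g • α.ι x = α.ι y ↔ x ∈ α.toMaps.dom g⁻¹ ∧ α.toMaps.act g x = y := by
  rw [smul_ι, ι, toEnvelope_eq_iff, mul_one, inv_one, one_mul]

theorem ι_injective (α : PartialAction G X) : Function.Injective α.ι := by
  intro x y h
  have h' : (1 : G) • α.ι x = α.ι y := by rw [one_smul, h]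
  rw [← (α.smul_ι_eq_ι_iff.1 h').2, α.act_one]

theorem isOpen_dom (α : PartialAction G X) (g : G) : IsOpen (α.toMaps.dom g) :=
  (α.homeo g).open_target

theorem continuousOn_toMaps_act (α : PartialAction G X) (g : G) :
    ContinuousOn (α.toMaps.act g) (α.toMaps.dom g⁻¹) := by
  have h := (α.homeo g).continuousOn
  rw [α.source_eq] at h
  exact h

/-- For fixed `x`, the set of `u` with `x ∈ X_{u⁻¹}` is open. -/
theorem isOpen_setOf_mem_dom_inv (α : PartialAction G X) (x : X) :
    IsOpen {u : G | x ∈ α.toMaps.dom u⁻¹} :=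
  α.isOpen_germs.preimage (Continuous.prodMk_left x)

variable [IsTopologicalGroup G]

theorem isOpenQuotientMap_toEnvelope (α : PartialAction G X) :
    IsOpenQuotientMap fun p : X × G => α.toEnvelope p.1 p.2 := by
  have hq : IsQuotientMap fun p : X × G => α.toEnvelope p.1 p.2 := isQuotientMap_quot_mk
  refine ⟨hq.surjective, hq.continuous, fun U hU => ?_⟩
  rw [← hq.isOpen_preimage]
  -- the saturation of `U` is the union of its images under `(x, r) ↦ (α_g(x), r g⁻¹)`
  have h : (fun p : X × G => α.toEnvelope p.1 p.2) ⁻¹'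
      ((fun p : X × G => α.toEnvelope p.1 p.2) '' U) =
      ⋃ g : G, (α.toMaps.dom g⁻¹ ×ˢ univ) ∩
        (fun p : X × G => (α.toMaps.act g p.1, p.2 * g⁻¹)) ⁻¹' U := by
    ext ⟨y, s⟩
    simp only [mem_preimage, mem_image, Prod.exists, mem_iUnion, mem_inter_iff, mem_prod, mem_univ,
      and_true]
    constructor
    · rintro ⟨x, r, hU, he⟩
      obtain ⟨h1, h2⟩ := α.toEnvelope_eq_iff.1 he.symm
      refine ⟨r⁻¹ * s, by simpa using h1, ?_⟩
      rw [h2]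
      simpa using hU
    · rintro ⟨g, h1, hU⟩
      refine ⟨_, _, hU, (α.toEnvelope_eq_iff.2 ⟨by simpa using h1, by simp⟩).symm⟩
  rw [h]
  refine isOpen_iUnion fun g => ContinuousOn.isOpen_inter_preimage ?_
    ((α.isOpen_dom _).prod isOpen_univ) hU
  exact ((α.continuousOn_toMaps_act g).comp continuousOn_fst fun p hp => hp.1).prodMk
    (continuous_snd.mul continuous_const).continuousOn

/-- The product of `id` with an open quotient map is a quotient map, so continuity can be checked
on `G × X × G`. -/
instance (α : PartialAction G X) : ContinuousSMul G α.Envelope where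
  continuous_smul := by
    have h := IsOpenQuotientMap.id.prodMap α.isOpenQuotientMap_toEnvelope (X := G)
    rw [h.isQuotientMap.continuous_iff]
    have h2 : ((fun p : G × α.Envelope => p.1 • p.2) ∘
        Prod.map id fun p : X × G => α.toEnvelope p.1 p.2) =
        fun q : G × X × G => α.toEnvelope q.2.1 (q.1 * q.2.2) := rfl
    rw [h2]
    exact α.isOpenQuotientMap_toEnvelope.continuous.comp
      (continuous_snd.fst.prodMk (continuous_fst.mul continuous_snd.snd))

instance [SecondCountableTopology X] [SecondCountableTopology G] (α : PartialAction G X) :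
    SecondCountableTopology α.Envelope :=
  α.isOpenQuotientMap_toEnvelope.isQuotientMap.secondCountableTopology
    α.isOpenQuotientMap_toEnvelope.isOpenMap

instance (α : PartialAction G X) : BorelSpace α.Envelope := ⟨rfl⟩

theorem isOpenEmbedding_ι (α : PartialAction G X) : IsOpenEmbedding α.ι := by
  have hq := α.isOpenQuotientMap_toEnvelope
  refine .of_continuous_injective_isOpenMap
    (hq.continuous.comp (Continuous.prodMk_left (1 : G))) α.ι_injective fun U hU => ?_
  rw [← hq.isQuotientMap.isOpen_preimage]
  have h : (fun p : X × G => α.toEnvelope p.1 p.2) ⁻¹' (α.ι '' U) =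
      Prod.swap ⁻¹' ({p : G × X | p.2 ∈ (α.homeo p.1⁻¹).target} ∩
        (fun p : G × X => α.homeo p.1 p.2) ⁻¹' U) := by
    ext ⟨y, s⟩
    constructor
    · rintro ⟨x, hx, he⟩
      change α.ι x = α.toEnvelope y s at he
      rw [← smul_ι, eq_comm, smul_ι_eq_ι_iff] at he
      obtain ⟨h1, rfl⟩ := he
      exact ⟨h1, hx⟩
    · rintro ⟨h1, h2⟩
      refine ⟨_, h2, ?_⟩
      change _ = α.toEnvelope y s
      rw [← smul_ι, eq_comm, smul_ι_eq_ι_iff]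
      exact ⟨h1, rfl⟩
  rw [h]
  exact (α.continuousOn_act.isOpen_inter_preimage α.isOpen_germs hU).preimage continuous_swap

section Chart

variable [SecondCountableTopology G] [MeasurableSpace X] [BorelSpace X]

/-- The envelope is exhausted by countably many translates `t n • ι(X)` of `X`, with `t 0 = 1`. The
chart `(N, π)` assigns to `z` the first translate which contains it and its position there. -/
theorem exists_chart (α : PartialAction G X) : ∃ (t : ℕ → G) (N : α.Envelope → ℕ)
    (π : α.Envelope → X), Measurable N ∧ Measurable π ∧ (∀ z, t (N z) • α.ι (π z) = z) ∧
      ∀ x, t (N (α.ι x)) = 1 ∧ π (α.ι x) = x := by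
  classical
  -- `ι(X)` itself comes first, so that the chart is trivial on it
  let t : ℕ → G := fun n => n.casesOn 1 (TopologicalSpace.denseSeq G)
  have hcov : ∀ z, ∃ n, ∃ x, t n • α.ι x = z := by
    intro z
    obtain ⟨⟨x, r⟩, rfl⟩ := α.isOpenQuotientMap_toEnvelope.surjective z
    have hopen : IsOpen {s : G | x ∈ α.toMaps.dom (s⁻¹ * r)⁻¹} :=
      (α.isOpen_setOf_mem_dom_inv x).preimage (continuous_inv.mul continuous_const)
    obtain ⟨n, hn⟩ := (TopologicalSpace.denseRange_denseSeq G).exists_mem_open hopen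
      ⟨r, by simpa using α.mem_dom_one x⟩
    refine ⟨n + 1, α.toMaps.act ((TopologicalSpace.denseSeq G n)⁻¹ * r) x, ?_⟩
    rw [smul_ι]
    exact (α.toEnvelope_eq_iff.2 ⟨by simpa using hn, rfl⟩).symm
  have hWm : ∀ (n : ℕ) (B : Set X), MeasurableSet B →
      MeasurableSet {z | ∃ x ∈ B, t n • α.ι x = z} := by
    intro n B hB
    have h : {z | ∃ x ∈ B, t n • α.ι x = z} = ((t n)⁻¹ • ·) ⁻¹' (α.ι '' B) := by
      ext z
      simp only [mem_ofPred_eq, mem_preimage, mem_image, eq_inv_smul_iff]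
    rw [h]
    exact (continuous_const_smul _).measurable
      (α.isOpenEmbedding_ι.measurableEmbedding.measurableSet_image.2 hB)
  choose π hπ using fun z => Nat.find_spec (hcov z)
  have hN : Measurable fun z => Nat.find (hcov z) := measurable_find hcov fun n => by
    simpa using hWm n univ .univ
  have hN0 : ∀ x, Nat.find (hcov (α.ι x)) = 0 := fun x =>
    (Nat.find_eq_zero _).2 ⟨x, one_smul G _⟩
  have hinj : ∀ n, Function.Injective fun x => t n • α.ι x := fun n x y h =>
    α.ι_injective (MulAction.injective (t n) h)
  refine ⟨t, fun z => Nat.find (hcov z), π, hN, fun B hB => ?_, hπ, fun x => ?_⟩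
  · have h : π ⁻¹' B = ⋃ n, (fun z => Nat.find (hcov z)) ⁻¹' {n} ∩
        {z | ∃ x ∈ B, t n • α.ι x = z} := by
      ext z
      simp only [mem_preimage, mem_iUnion, mem_inter_iff, mem_singleton_iff, exists_eq_left',
        mem_ofPred_eq]
      constructor
      · exact fun hz => ⟨_, hz, hπ z⟩
      · rintro ⟨x, hx, hz⟩
        rwa [hinj _ ((hπ z).trans hz.symm)]
    rw [h]
    exact .iUnion fun n => (hN (measurableSet_singleton n)).inter (hWm n B hB)
  · have h := hπ (α.ι x)
    rw [hN0] at h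
    exact ⟨congrArg t (hN0 x), α.ι_injective ((one_smul G _).symm.trans h)⟩

/-- The chart identifies the envelope with a Borel subset of `ℕ × X`, although the envelope need not
be Hausdorff. -/
instance [StandardBorelSpace X] (α : PartialAction G X) : StandardBorelSpace α.Envelope := by
  obtain ⟨t, N, π, hN, hπ, hz, -⟩ := α.exists_chart
  let F : α.Envelope → ℕ × X := fun z => (N z, π z)
  let g : ℕ × X → α.Envelope := fun w => t w.1 • α.ι w.2
  have hF : Measurable F := hN.prodMk hπ
  have hg : Measurable g := measurable_from_prod_countable_right fun n =>
    (continuous_const_smul (t n)).measurable.comp α.isOpenEmbedding_ι.continuous.measurable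
  have hgF : ∀ z, g (F z) = z := hz
  have : StandardBorelSpace {w : ℕ × X | F (g w) = w} :=
    (measurableSet_eq_fun (hF.comp hg) measurable_id).standardBorel
  let e : α.Envelope ≃ᵐ {w : ℕ × X | F (g w) = w} :=
    { toFun := fun z => ⟨F z, congrArg F (hgF z)⟩
      invFun := fun w => g w.1
      left_inv := hgF
      right_inv := fun w => Subtype.ext w.2
      measurable_toFun := hF.subtype_mk
      measurable_invFun := hg.comp measurable_subtype_coe }
  exact e.standardBorelSpace

end Chart

end PartialAction

/-! ### From the enveloping space to `X` -/

namespace PartialAction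

variable {G X : Type u} [Group G] [TopologicalSpace G] [IsTopologicalGroup G]
  [TopologicalSpace X]

/-- Quasi-invariance under the enveloping action, as absolute continuity of the translates. -/
theorem map_smul_absolutelyContinuous {α : PartialAction G X} {νe : Measure α.Envelope}
    (hνe : α.envelopeMaps.QuasiInvariant νe) (s : G) : νe.map (s • ·) ≪ νe := by
  refine Measure.AbsolutelyContinuous.mk fun B hB hB0 => ?_
  rw [Measure.map_apply (continuous_const_smul s).measurable hB]
  have h := hνe s⁻¹ B hB (subset_univ _) hB0
  refine measure_mono_null (fun z hz => ?_) h
  exact ⟨s • z, hz, inv_smul_smul s z⟩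

section NullSets

variable [MeasurableSpace X] [BorelSpace X] {α : PartialAction G X} {ν : Measure X}
  {νe : Measure α.Envelope} (hι : ∀ B : Set X, MeasurableSet B → (νe (α.ι '' B) = 0 ↔ ν B = 0))
include hι

/-- As `νe` restricts to the class of `ν` along `ι`, a property of almost every point of the
envelope holds at `ι x` for almost every `x`. -/
theorem ae_comp_ι {p : α.Envelope → Prop} (h : ∀ᵐ z ∂νe, p z) : ∀ᵐ x ∂ν, p (α.ι x) := by
  obtain ⟨N, hpN, hN, hN0⟩ := exists_measurable_superset_of_null h
  refine measure_mono_null (t := α.ι ⁻¹' N) (fun x hx => hpN hx) ?_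
  refine (hι _ (α.isOpenEmbedding_ι.continuous.measurable hN)).1 ?_
  exact measure_mono_null (image_preimage_subset _ _) hN0

/-- Conversely, a property of almost every point of `X` holds at the position `π z` of almost every
point `z` of the envelope, since the exceptional set is covered by countably many translates of an
image under `ι` of a null set. -/
theorem ae_of_chart (hνe : α.envelopeMaps.QuasiInvariant νe) {t : ℕ → G} {N : α.Envelope → ℕ}
    {π : α.Envelope → X} (hz : ∀ z, t (N z) • α.ι (π z) = z) {p : X → Prop}
    (h : ∀ᵐ x ∂ν, p x) : ∀ᵐ z ∂νe, p (π z) := by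
  obtain ⟨M, hpM, hM, hM0⟩ := exists_measurable_superset_of_null h
  refine measure_mono_null (t := ⋃ n, (t n • ·) '' (α.ι '' M)) (fun z hpz => ?_)
    (measure_iUnion_null fun n => ?_)
  · exact mem_iUnion.2 ⟨N z, _, mem_image_of_mem _ (hpM hpz), hz z⟩
  · exact hνe (t n) _ (α.isOpenEmbedding_ι.measurableEmbedding.measurableSet_image.2 hM)
      (subset_univ _) ((hι M hM).2 hM0)

theorem ne_zero_of_envelope_ne_zero [SecondCountableTopology G]
    (hνe : α.envelopeMaps.QuasiInvariant νe) (h : νe ≠ 0) : ν ≠ 0 := by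
  rintro rfl
  obtain ⟨t, N, π, -, -, hz, -⟩ := α.exists_chart
  have h1 : ∀ᵐ z ∂νe, False := ae_of_chart hι hνe hz (p := fun _ => False) (by simp)
  exact h (ae_eq_bot.1 (Filter.eventually_false_iff_eq_bot.1 h1))

end NullSets

variable [SecondCountableTopology G] [MeasurableSpace G] [BorelSpace G]
  [SecondCountableTopology X] [MeasurableSpace X] [BorelSpace X]

/-- Amenability passes from the enveloping space to `X`. Along a chart `z = d(z) • ι(π z)`, a
cocycle `σ` and a field `A` on `X` extend to the envelope as `σ(π z, d(sz)⁻¹ s d(z))` and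
`A (π z)`, and an invariant section of the extension restricts along `ι`. -/
theorem zimmerAmenable_of_envelope (𝕜 : Type) [RCLike 𝕜] (α : PartialAction G X)
    (ν : Measure X) (νe : Measure α.Envelope) (hνe : α.envelopeMaps.QuasiInvariant νe)
    (hι : ∀ B : Set X, MeasurableSet B → (νe (α.ι '' B) = 0 ↔ ν B = 0))
    (h : α.envelopeMaps.ZimmerAmenable 𝕜 νe) : α.toMaps.ZimmerAmenable 𝕜 ν := by
  intro E _ _ _ _ σ A hσ hA
  obtain ⟨t, N, π, hN, hπ, hz, hιx⟩ := α.exists_chart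
  let d : α.Envelope → G := fun z => t (N z)
  have hd : Measurable d := (measurable_of_countable t).comp hN
  -- the action of `s` moves the position `π z` of `z` by the element `g z s`
  let g : α.Envelope → G → G := fun z s => (d (s • z))⁻¹ * s * d z
  have hg : ∀ z s, π z ∈ α.toMaps.dom (g z s)⁻¹ ∧ α.toMaps.act (g z s) (π z) = π (s • z) := by
    intro z s
    refine α.smul_ι_eq_ι_iff.1 ?_
    rw [mul_smul, mul_smul, hz, inv_smul_eq_iff, hz]
  have hgmul : ∀ z s u, g z (u * s) = g (s • z) u * g z s := by
    intro z s u
    simp only [g, mul_smul]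
    group
  have hgι : ∀ x s, x ∈ α.toMaps.dom s⁻¹ →
      g (α.ι x) s = s ∧ s • α.ι x = α.ι (α.toMaps.act s x) := by
    intro x s hx
    have h1 : s • α.ι x = α.ι (α.toMaps.act s x) := α.smul_ι_eq_ι_iff.2 ⟨hx, rfl⟩
    refine ⟨?_, h1⟩
    simp only [g, d]
    rw [h1, (hιx _).1, (hιx _).1, inv_one, one_mul, mul_one]
  -- the cocycle and the field of `X`, transported along the chart
  let σe : α.Envelope × G → (E ≃ₗᵢ[𝕜] E) := fun p => σ (π p.1, g p.1 p.2)
  let Ae : α.Envelope → Set (DualBall 𝕜 E) := fun z => A (π z)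
  have hσe : α.envelopeMaps.IsCocycle 𝕜 σe := by
    refine ⟨?_, fun s u z _ _ _ => ?_⟩
    · have hm : Measurable fun p : α.envelopeMaps.germs => (π p.1.1, g p.1.1 p.1.2) := by
        have h1 : Measurable fun p : α.Envelope × G => p.2 • p.1 :=
          measurable_snd.smul measurable_fst
        exact ((hπ.comp measurable_fst).prodMk (((hd.comp h1).inv.mul measurable_snd).mul
          (hd.comp measurable_fst))).comp measurable_subtype_coe
      have hm' : Measurable fun p : α.envelopeMaps.germs =>
          (⟨(π p.1.1, g p.1.1 p.1.2), (hg p.1.1 p.1.2).1⟩ : α.toMaps.germs) := hm.subtype_mk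
      exact hσ.borel.comp hm'
    · change σ (π z, g z (u * s)) = σ (π z, g z s) * σ (π (s • z), g (s • z) u)
      have h1 := hg z (u * s)
      rw [hgmul] at h1 ⊢
      rw [hσ.mul (g z s) (g (s • z) u) (π z) (hg z s).1 (by rw [(hg z s).2]; exact (hg (s • z) u).1)
        h1.1, (hg z s).2]
  have hAe : α.envelopeMaps.IsInvariantField νe σe Ae := by
    refine ⟨fun z => hA.nonempty _, fun z => hA.compact _, fun z => hA.convex _, ?_, fun s => ?_⟩
    · exact ((hπ.comp measurable_fst).prodMk measurable_snd) hA.borel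
    · have h1 : ∀ m n : ℕ, ∀ᵐ x ∂ν, x ∈ α.toMaps.dom ((t m)⁻¹ * s * t n)⁻¹ →
          DualBall.invAdjoint (σ (x, (t m)⁻¹ * s * t n)) ''
            A (α.toMaps.act ((t m)⁻¹ * s * t n) x) = A x := fun m n => hA.invariant _
      filter_upwards [ae_of_chart hι hνe hz (ae_all_iff.2 fun m => ae_all_iff.2 (h1 m))]
        with z hz' _
      have h2 := hz' (N (s • z)) (N z) (hg z s).1
      change DualBall.invAdjoint (σ (π z, g z s)) '' A (α.toMaps.act (g z s) (π z)) = _ at h2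
      rwa [(hg z s).2] at h2
  obtain ⟨η, hη, hηA, hηi⟩ := h E σe Ae hσe hAe
  refine ⟨fun x => η (α.ι x), hη.comp α.isOpenEmbedding_ι.continuous.measurable, ?_, fun s => ?_⟩
  · filter_upwards [ae_comp_ι hι hηA] with x hx
    change η (α.ι x) ∈ A (π (α.ι x)) at hx
    rwa [(hιx x).2] at hx
  · filter_upwards [ae_comp_ι hι (hηi s)] with x hx hxs
    have h1 := hx (mem_univ _)
    change DualBall.invAdjoint (σ (π (α.ι x), g (α.ι x) s)) (η (s • α.ι x)) = _ at h1
    rwa [(hιx x).2, (hgι x s hxs).1, (hgι x s hxs).2] at h1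

/-! ### From the quotient to the enveloping space -/

/-- Amenability passes from the quotient `Y` to the enveloping space. The action on `Y` is trivial,
so the regular representation on `L¹(μ; E)` is a cocycle on `Y` not depending on the point, and
the functionals given by the sections of a field form an invariant constant field. The value at a
generic `x` of an invariant section is fixed by the `s` with `x ∈ X_{s⁻¹}`, and partial transitivity
says that their quotients exhaust `G`. -/
theorem envelope_zimmerAmenable_of_orbit (𝕜 : Type) [RCLike 𝕜] [LocallyCompactSpace G] [T2Space G]
    [StandardBorelSpace X] (α : PartialAction G X) (hα : α.PartiallyTransitive)
    (ν : Measure X) (νe : Measure α.Envelope) [SigmaFinite νe]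
    (hνe : α.envelopeMaps.QuasiInvariant νe)
    (hι : ∀ B : Set X, MeasurableSet B → (νe (α.ι '' B) = 0 ↔ ν B = 0))
    (h : α.orbitMaps.ZimmerAmenable 𝕜 (ν.map α.toOrbit)) :
    α.envelopeMaps.ZimmerAmenable 𝕜 νe := by
  intro E _ _ _ _ σ A hσ hA
  rcases eq_or_ne νe 0 with rfl | hνe0
  -- there is no generic point if the measure vanishes, but then nothing has to be checked
  · exact ⟨fun _ => default, measurable_const, by simp, by simp⟩
  -- an equivalent finite measure
  let μ : Measure α.Envelope := νe.toFinite
  have hμ1 : μ ≪ νe := toFinite_absolutelyContinuous νe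
  have hμ2 : νe ≪ μ := absolutelyContinuous_toFinite νe
  have hμ : ∀ s : G, μ.map (s • ·) ≪ μ := fun s =>
    ((hμ1.map (measurable_const_smul s)).trans (map_smul_absolutelyContinuous hνe s)).trans hμ2
  have hσ' : IsStrongCocycle σ := by
    refine ⟨fun x => ?_, fun s u z => hσ.mul s u z (mem_univ _) (mem_univ _) (mem_univ _)⟩
    have h1 := stronglyMeasurable_eval_of_isoBorel hσ.borel x
    exact h1.comp_measurable
      (g := fun p : α.Envelope × G => (⟨p, mem_univ _⟩ : α.envelopeMaps.germs))
      measurable_id.subtype_mk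
  have hA' : DualBall.IsBorelField A := ⟨hA.nonempty, hA.compact, hA.convex, hA.borel⟩
  have hAinv : ∀ s : G, ∀ᵐ z ∂μ, DualBall.invAdjoint (σ (z, s)) '' A (s • z) = A z := fun s =>
    hμ1.ae_le ((hA.invariant s).mono fun z hz => hz (mem_univ _))
  let V := Lp E 1 μ
  let U : G → (V ≃ₗᵢ[𝕜] V) := regularRep hμ hσ'
  have : Fact ((1 : ENNReal) ≠ ⊤) := ⟨ENNReal.one_ne_top⟩
  have : SecondCountableTopology V := Lp.SecondCountableTopology
  have hUc : ∀ f : V, Continuous fun s => U s f := fun f =>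
    continuous_of_measurable_isometric (regularRep_mul hμ hσ')
      (measurable_norm_regularRep_sub hμ hσ' f)
  let K : Set (DualBall 𝕜 V) := DualBall.sectionFunctionals μ A
  have hact : ∀ (s : G) (y : α.OrbitSpace), y ∈ α.orbitMaps.dom s⁻¹ → α.orbitMaps.act s y = y := by
    rintro s _ ⟨x, hx, rfl⟩
    rw [α.orbitMaps_act hx, α.toOrbit_act hx]
  have hcoc : α.orbitMaps.IsCocycle 𝕜 fun p => U p.2 := by
    refine ⟨?_, fun s u y _ _ _ => regularRep_mul hμ hσ' s u⟩
    let _ : TopologicalSpace (V ≃ₗᵢ[𝕜] V) :=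
      TopologicalSpace.induced (fun (T : V ≃ₗᵢ[𝕜] V) (x : V) => T x) inferInstance
    let _ : MeasurableSpace (V ≃ₗᵢ[𝕜] V) := isoBorel 𝕜 V
    have : BorelSpace (V ≃ₗᵢ[𝕜] V) := ⟨rfl⟩
    have hU : Continuous U := continuous_induced_rng.2 (continuous_pi hUc)
    exact hU.measurable.comp (measurable_snd.comp measurable_subtype_coe)
  have hK : α.orbitMaps.IsInvariantField (ν.map α.toOrbit) (fun p => U p.2) fun _ => K := by
    refine ⟨fun _ => hA'.nonempty_sectionFunctionals,
      fun _ => hA'.isClosed_sectionFunctionals.isCompact,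
      fun _ => hA'.isConvex_sectionFunctionals,
      measurable_snd hA'.isClosed_sectionFunctionals.measurableSet, fun s => ?_⟩
    exact ae_of_all _ fun y _ => invAdjoint_regularRep_image_sectionFunctionals hμ hσ' hAinv s
  obtain ⟨η, -, hηK, hηi⟩ := h V _ _ hcoc hK
  have hp : Measurable α.toOrbit := measurable_quotient_mk''
  have : (ae ν).NeBot := ae_neBot.2 (ne_zero_of_envelope_ne_zero hι hνe hνe0)
  obtain ⟨D, hDc, hDd⟩ := TopologicalSpace.exists_countable_dense G
  have : Countable D := hDc.to_subtype
  -- a generic point `x`, at which all the conditions indexed by `D` hold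
  obtain ⟨x, hxK, hxi⟩ := ((ae_of_ae_map hp.aemeasurable hηK).and
    (ae_all_iff.2 fun s : D => ae_of_ae_map hp.aemeasurable (hηi s))).exists
  obtain ⟨φ, hφ, hφA, hΦ⟩ := hxK
  set Φ : DualBall 𝕜 V := η (α.toOrbit x)
  -- the stabilizer of `Φ`, a closed subgroup
  let H : Set G := {s | ∀ f, Φ.val (U s f) = Φ.val f}
  have hH : ∀ s, DualBall.invAdjoint (U s) Φ = Φ ↔ s ∈ H := by
    refine fun s => ⟨fun hs f => ?_, fun hs => DualBall.ext_of_apply fun f => ?_⟩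
    · have h1 : (DualBall.invAdjoint (U s) Φ).val (U s f) = Φ.val (U s f) := by rw [hs]
      exact h1.symm.trans (congrArg Φ.val ((U s).symm_apply_apply f))
    · exact (hs ((U s).symm f)).symm.trans (congrArg Φ.val ((U s).apply_symm_apply f))
  have hHc : IsClosed H := by
    have h1 : H = ⋂ f : V, {s | Φ.val (U s f) = Φ.val f} := by
      ext s
      simp only [mem_iInter]
      rfl
    rw [h1]
    exact isClosed_iInter fun f =>
      isClosed_eq ((WeakDual.toStrongDual Φ.val).continuous.comp (hUc f)) continuous_const
  -- the conditions hold on a dense subset of the open set of these `s`, and `H` is closed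
  have hT : {s : G | x ∈ α.toMaps.dom s⁻¹} ⊆ H := by
    have hD : {s : G | x ∈ α.toMaps.dom s⁻¹} ∩ D ⊆ H := by
      rintro s ⟨hs, hsD⟩
      have hxs : α.toOrbit x ∈ α.orbitMaps.dom s⁻¹ := mem_image_of_mem _ hs
      have h1 := hxi ⟨s, hsD⟩ hxs
      rw [hact s _ hxs] at h1
      exact (hH s).1 h1
    exact (hDd.open_subset_closure_inter (α.isOpen_setOf_mem_dom_inv x)).trans
      (closure_minimal hD hHc)
  have hHuniv : ∀ g : G, g ∈ H := by
    intro g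
    -- `g = (g r) r⁻¹`, where `(g r)⁻¹` and `r⁻¹` fix `Φ`
    have h1 : x ∈ ⋃ r : G, α.toMaps.dom (g * r) ∩ α.toMaps.dom (1 * r) := by
      rw [hα g 1]
      exact mem_univ x
    obtain ⟨r, hr1, hr2⟩ := mem_iUnion.1 h1
    have h2 : (g * r)⁻¹ ∈ H := hT (by simpa using hr1)
    have h3 : r⁻¹ ∈ H := hT (by simpa using hr2)
    intro f
    have hU : ∀ s t f, U (t * s) f = U s (U t f) := regularIsometry_mul hμ hσ'
    have h4 := h2 (U (g * r) f)
    rw [← hU, mul_inv_cancel] at h4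
    have h5 : U 1 f = f := regularIsometry_one hμ hσ' f
    rw [h5] at h4
    rw [h4, ← h3 (U (g * r) f), ← hU, mul_inv_cancel_right]
  refine ⟨φ, hφ, hμ2.ae_le hφA, fun s => ?_⟩
  have h1 : DualBall.invAdjoint (regularRep hμ hσ' s) (DualBall.integralFunctional μ φ hφ) =
      DualBall.integralFunctional μ φ hφ := by
    rw [← hΦ]
    exact (hH s).2 (hHuniv s)
  filter_upwards [hμ2.ae_le (ae_eq_of_invAdjoint_regularRep_eq hμ hσ' hφ h1)] with z hz _
  exact hz

end PartialAction

theorem mainTheorem2 (𝕜 : Type) [RCLike 𝕜] {G X : Type u}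
    [Group G] [TopologicalSpace G] [IsTopologicalGroup G] [LocallyCompactSpace G]
    [SecondCountableTopology G] [T2Space G] [MeasurableSpace G] [BorelSpace G]
    [TopologicalSpace X] [SecondCountableTopology X]
    [MeasurableSpace X] [BorelSpace X] [StandardBorelSpace X]
    (α : PartialAction G X) (hα : α.PartiallyTransitive)
    (ν : Measure X) [SigmaFinite ν] (hν : α.toMaps.QuasiInvariant ν)
    (νe : Measure α.Envelope) [SigmaFinite νe] (hνe : α.envelopeMaps.QuasiInvariant νe)
    (hι : ∀ B : Set X, MeasurableSet B → (νe (α.ι '' B) = 0 ↔ ν B = 0)) :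
    (α.envelopeMaps.ZimmerAmenable 𝕜 νe → α.toMaps.ZimmerAmenable 𝕜 ν) ∧
      (α.orbitMaps.ZimmerAmenable 𝕜 (ν.map α.toOrbit) →
        α.envelopeMaps.ZimmerAmenable 𝕜 νe) :=
  ⟨α.zimmerAmenable_of_envelope 𝕜 ν νe hνe hι,
    α.envelope_zimmerAmenable_of_orbit 𝕜 hα ν νe hνe hι⟩
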